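/- Let $d\ge 1$ and let $\mathbb S^d\subset\mathbb R^{d+1}$ be the unit sphere with surface measure $\sigma$ and total surface measure $\omega_d$; $L^p$ norms on $\mathbb S^d$ are taken with respect to $\sigma/\omega_d$. For $f:\mathbb S^d\to\mathbb R$ integrable and $g:[-1,1]\to\mathbb R$ continuous put $f*g(x)=\frac1{\omega_d}\int_{\mathbb S^d}f(y)\,g(\langle x,y\rangle)\,d\sigma(y)$. Let $Z_0=1$ and, for $n\ge1$, $$Z_n(\tau)=(2n+d-1)\,\frac{\Gamma(\frac d2)\,\Gamma(d+n-1)}{\Gamma(d)\,\Gamma(n+\frac d2)}\,P_n^{(\frac{d-2}2,\frac{d-2}2)}(\tau)$$ be the zonal harmonics ($P_n^{(\alpha,\beta)}$ being the Jacobi polynomials), so that $f*Z_n$ is the projection of $f$ onto the spherical harmonics of degree $n$. Let $a\in C^\infty([0,\infty))$ be any real-valued function with $\operatorname{supp}a\subset[\frac12,2]$, with $|a|>c$ on $[\frac35,\frac53]$ for some constant $c>0$, and with $a(t)+a(2t)=1$ for $t\in[\frac12,1]$. Put $\Phi_0=Z_0$, $\Phi_j=\sum_{n\ge0}a(2^{-j+1}n)Z_n$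 for $j\ge1$, and, for $\alpha\in\mathbb R$, let $B^{\alpha}_{1,\infty}(\mathbb S^d)$ denote the set of integrable $f:\mathbb S^d\to\mathbb R$ with $$\|f\|_{B^\alpha_{1,\infty}}=\sup_{j\ge0}2^{j\alpha}\,\|f*\Phi_j\|_{L^1(\mathbb S^d)}<\infty .$$ For a bounded set $E\subset\mathbb R^m$ let $\overline{\dim}\,E=\limsup_{\epsilon\to0+}\frac{\log\mathcal N(E,\epsilon)}{\log(1/\epsilon)}$ be its upper box dimension, where $\mathcal N(E,\epsilon)$ is the minimal number of axis-parallel cubes of side length $\epsilon$ needed to cover $E$. **Theorem.** Let $s\in\mathbb R$ and let $f:\mathbb S^d\to\mathbb R$ be continuous with $f\notin\bigcup_{\epsilon>0}B^{s+\epsilon}_{1,\infty}(\mathbb S^d)$. Then the graph $\{(x,f(x)):x\in\mathbb S^d\}\subset\mathbb R^{d+2}$ of $f$ has upper box dimension at least $(d+1)-s$. -/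

import Mathlib

open MeasureTheory Filter Topology
open scoped ENNReal NNReal ContDiff

noncomputable section

namespace SphBesov

/-- The unit sphere `S^d` in the Euclidean space `ℝ^(d+1)`. -/
abbrev Sph (d : ℕ) : Type := Metric.sphere (0 : EuclideanSpace ℝ (Fin (d + 1))) 1

/-- The normalized surface measure `dσ / ω_d` on `S^d`. -/
def sphMeasure (d : ℕ) : Measure (Sph d) :=
  ((volume : Measure (EuclideanSpace ℝ (Fin (d + 1)))).toSphere Set.univ)⁻¹ •
    (volume : Measure (EuclideanSpace ℝ (Fin (d + 1)))).toSphere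

/-- Spherical convolution `(f * g)(x) = (1 / ω_d) ∫_{S^d} f(y) g(⟨x, y⟩) dσ(y)`. -/
def sphConv {d : ℕ} (f : Sph d → ℝ) (g : ℝ → ℝ) (x : Sph d) : ℝ :=
  ∫ y : Sph d,
    f y * g (inner ℝ (x : EuclideanSpace ℝ (Fin (d + 1))) (y : EuclideanSpace ℝ (Fin (d + 1))))
    ∂(sphMeasure d)

/-- The Jacobi polynomial `P_n^{(α, β)}` with its classical normalization,
`(1 / n!) ∑_{m ≤ n} (n choose m) (n + α + β + 1)_m (α + m + 1)_{n - m} ((t - 1) / 2)^m`,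
where `(x)_m = x (x + 1) ⋯ (x + m - 1)`. -/
def jacobiP (α β : ℝ) (n : ℕ) (t : ℝ) : ℝ :=
  (n.factorial : ℝ)⁻¹ * ∑ m ∈ Finset.range (n + 1),
    (n.choose m : ℝ) * (ascPochhammer ℝ m).eval ((n : ℝ) + α + β + 1) *
      (ascPochhammer ℝ (n - m)).eval (α + (m : ℝ) + 1) * ((t - 1) / 2) ^ m

/-- The zonal harmonic `Z_n` on `S^d`, i.e. the reproducing kernel of the spherical harmonics of
degree `n` for the normalized measure. For `d ≥ 2` the second branch is
`(2n/(d-1) + 1) Γ(d/2) Γ(d+n-1) / (Γ(d-1) Γ(n+d/2)) P_n^{((d-2)/2, (d-2)/2)}`, which is `1` for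
`n = 0`; in the form below it also covers the circle `d = 1`, where it is `2 cos (n θ)`. -/
def zonal (d n : ℕ) (t : ℝ) : ℝ :=
  if n = 0 then 1 else
    (2 * (n : ℝ) + d - 1) * (Real.Gamma ((d : ℝ) / 2) * Real.Gamma ((d : ℝ) + n - 1)) /
      (Real.Gamma (d : ℝ) * Real.Gamma ((n : ℝ) + (d : ℝ) / 2)) *
      jacobiP (((d : ℝ) - 2) / 2) (((d : ℝ) - 2) / 2) n t

/-- Admissible smooth cut-offs. A smooth function on `[0, ∞)` supported in `[1/2, 2]` is
extended by zero to the negative half line. -/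
structure IsCutoff (a : ℝ → ℝ) : Prop where
  smooth : ContDiff ℝ ∞ a
  supp : tsupport a ⊆ Set.Icc (1 / 2) 2
  lower : ∃ c : ℝ, 0 < c ∧ ∀ t ∈ Set.Icc (3 / 5 : ℝ) (5 / 3), c < |a t|
  partition : ∀ t ∈ Set.Icc (1 / 2 : ℝ) 1, a t + a (2 * t) = 1

/-- `Φ_0 = Z_0` and `Φ_j = ∑_{n ≥ 0} a(2^(1-j) n) Z_n` for `j ≥ 1`; the sum has finitely many
nonzero terms when `a` is an admissible cut-off. -/
def lpKernel (d : ℕ) (a : ℝ → ℝ) (j : ℕ) (t : ℝ) : ℝ :=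
  if j = 0 then zonal d 0 t
  else ∑' n : ℕ, a ((2 : ℝ) ^ (1 - (j : ℤ)) * (n : ℝ)) * zonal d n t

/-- The norm of `B^α_{p, ∞}(S^d)`: `sup_{j ≥ 0} 2^(jα) ‖f * Φ_j‖_{L^p}`, in `[0, ∞]`. -/
def besovNorm {d : ℕ} (a : ℝ → ℝ) (α : ℝ) (p : ℝ≥0∞) (f : Sph d → ℝ) : ℝ≥0∞ :=
  ⨆ j : ℕ, ENNReal.ofReal ((2 : ℝ) ^ ((j : ℝ) * α)) *
    eLpNorm (sphConv f (lpKernel d a j)) p (sphMeasure d)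

/-- The integrable functions on `S^d` that belong to the Besov space `B^α_{p, ∞}(S^d)`. -/
def besov (d : ℕ) (a : ℝ → ℝ) (α : ℝ) (p : ℝ≥0∞) : Set (Sph d → ℝ) :=
  {f | Integrable f (sphMeasure d) ∧ besovNorm a α p f < ⊤}

/-- The minimal number of boxes (axis-parallel cubes) of side length `ε` needed to cover `E`.
In `Fin m → ℝ`, which carries the sup metric, the closed balls of radius `ε / 2` are exactly the
closed cubes of side length `ε`. -/
def boxCount {m : ℕ} (E : Set (Fin m → ℝ)) (ε : ℝ) : ℕ∞ :=
  Metric.externalCoveringNumber (Real.toNNReal (ε / 2)) E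

/-- The upper Minkowski (box) dimension `limsup_{ε → 0+} log N(E, ε) / log (1 / ε)`. -/
def upperBoxDim {m : ℕ} (E : Set (Fin m → ℝ)) : EReal :=
  limsup (fun ε : ℝ => ENNReal.log (boxCount E ε : ℝ≥0∞) / ((Real.log (1 / ε) : ℝ) : EReal))
    (𝓝[>] (0 : ℝ))

/-- The graph `{(x, f x) : x ∈ S^d}` as a subset of `ℝ^(d+2)`. -/
def sphGraph {d : ℕ} (f : Sph d → ℝ) : Set (Fin (d + 2) → ℝ) :=
  Set.range fun x : Sph d =>
    (Fin.snoc (fun i => (x : EuclideanSpace ℝ (Fin (d + 1))) i) (f x) : Fin (d + 2) → ℝ)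

end SphBesov

end

/-! The proof is by contraposition. If the box dimension is below some γ < d + 1 - s, the graph is
covered by at most r^(-γ) cubes of every small side r. Put β = d + 1 - γ > s; it is shown that f
lies in B^β_{1,∞}.

Geometric half (`exists_oscillation_bound`): for |y - x| ≤ r the values between f(x) and f(y) are
all taken near x, since caps are connected. The cubes lying over a neighbourhood of x therefore
cover that interval, and |f(x) - f(y)| ≤ r · #{cubes near x}. Each cube is near x only for x in a
cap of measure O(r^d), so integration over x bounds the mean oscillation at scale r by r · r^(-γ) ·
r^d = r^β, up to a constant.

Analytic half (`mem_besov_of_oscillation`): Φ_j has mean zero for j ≥ 1, so f * Φ_j(x) is the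
integral of (f(y) - f(x)) Φ_j(⟨x, y⟩). On the annulus |y - x| ~ 2^k 2^(-j) the L¹ mass of Φ_j is
O(2^(k(d - 2M))) for any M (`exists_integral_annulus_le`), so the oscillation bounds at the scales
2^(k-j) sum to O(2^(-jβ)).

The localization of Φ_j is algebraic. By the three-term recurrence (`zonal_rec`), multiplying ∑ c_n
Z_n by 1 - τ applies to c a second-order difference operator (`diffOp`), which lowers the order of a
symbol by 2. The coefficients a(2^(-i) n) are symbols of order 0 uniformly in i, so Parseval's
identity bounds (1 - τ)^M Φ_j in L², and Cauchy–Schwarz on each annulus gives L¹. Orthogonality and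
the norms of Z_n follow from the same recurrence and from ∫ Z_n = 0. -/

namespace SphBesov

/-! ### Discrete symbol calculus for coefficient sequences -/

/-- `Symb K m c`: the first `K` forward differences of the sequences `c i` satisfy
`|Δ^k (c i) n| ≤ C (n + 1)^(-(m + k))` uniformly in `i`, that is, `c` is a family of symbols of
order `-m` up to depth `K`. -/
def Symb {ι : Type*} : ℕ → ℕ → (ι → ℕ → ℝ) → Prop
  | 0, m, c => ∃ C, ∀ i (n : ℕ), ((n : ℝ) + 1) ^ m * |c i n| ≤ C
  | K + 1, m, c => (∃ C, ∀ i (n : ℕ), ((n : ℝ) + 1) ^ m * |c i n| ≤ C) ∧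
      Symb K (m + 1) (fun i n => c i (n + 1) - c i n)

namespace Symb

variable {ι : Type*} {K m m' : ℕ} {c e : ι → ℕ → ℝ}

lemma bounded (h : Symb K m c) : ∃ C, ∀ i (n : ℕ), ((n : ℝ) + 1) ^ m * |c i n| ≤ C := by
  cases K with
  | zero => exact h
  | succ K => exact h.1

lemma pred (h : Symb (K + 1) m c) : Symb K m c := by
  induction K generalizing m c with
  | zero => exact h.1
  | succ K ih => exact ⟨h.1, ih h.2⟩

lemma add (hc : Symb K m c) (he : Symb K m e) : Symb K m (fun i n => c i n + e i n) := by
  induction K generalizing m c e with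
  | zero =>
    obtain ⟨C, hC⟩ := hc
    obtain ⟨C', hC'⟩ := he
    refine ⟨C + C', fun i n => ?_⟩
    calc ((n : ℝ) + 1) ^ m * |c i n + e i n| ≤ ((n : ℝ) + 1) ^ m * (|c i n| + |e i n|) := by
          gcongr; exact abs_add_le _ _
      _ ≤ C + C' := by rw [mul_add]; exact add_le_add (hC i n) (hC' i n)
  | succ K ih =>
    refine ⟨ih (m := m) (c := c) (e := e) (pred hc) (pred he) |>.bounded, ?_⟩
    have := ih hc.2 he.2
    convert this using 3
    ring

lemma const_mul (hc : Symb K m c) (a : ℝ) : Symb K m (fun i n => a * c i n) := by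
  induction K generalizing m c with
  | zero =>
    obtain ⟨C, hC⟩ := hc
    refine ⟨|a| * C, fun i n => ?_⟩
    rw [abs_mul, mul_left_comm]
    exact mul_le_mul_of_nonneg_left (hC i n) (abs_nonneg a)
  | succ K ih =>
    refine ⟨(ih (pred hc)).bounded, ?_⟩
    have := ih hc.2
    convert this using 3
    ring

lemma shift (hc : Symb K m c) : Symb K m (fun i n => c i (n + 1)) := by
  induction K generalizing m c with
  | zero =>
    obtain ⟨C, hC⟩ := hc
    refine ⟨C, fun i n => le_trans ?_ (hC i (n + 1))⟩
    push_cast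
    gcongr
    linarith
  | succ K ih => exact ⟨(ih (pred hc)).bounded, ih hc.2⟩

/-- Discrete Leibniz rule: Δ(ce) = Δc · e + (shift of c) · Δe, and each summand has order lower by
one. -/
lemma mul (hc : Symb K m c) (he : Symb K m' e) :
    Symb K (m + m') (fun i n => c i n * e i n) := by
  induction K generalizing m m' c e with
  | zero =>
    obtain ⟨C, hC⟩ := hc
    obtain ⟨C', hC'⟩ := he
    refine ⟨C * C', fun i n => ?_⟩
    have h1 : 0 ≤ ((n : ℝ) + 1) ^ m * |c i n| := by positivity
    have h2 : 0 ≤ ((n : ℝ) + 1) ^ m' * |e i n| := by positivity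
    calc ((n : ℝ) + 1) ^ (m + m') * |c i n * e i n|
        = (((n : ℝ) + 1) ^ m * |c i n|) * (((n : ℝ) + 1) ^ m' * |e i n|) := by
          rw [abs_mul, pow_add]; ring
      _ ≤ C * C' := mul_le_mul (hC i n) (hC' i n) h2 (h1.trans (hC i n))
  | succ K ih =>
    refine ⟨(ih (pred hc) (pred he)).bounded, ?_⟩
    have h1 := ih hc.2 (pred he)
    have h2 := ih (pred hc).shift he.2
    rw [show m + 1 + m' = m + m' + 1 by ring] at h1
    have := h1.add h2
    convert this using 3
    ring

lemma delta (hc : Symb (K + 1) m c) : Symb K (m + 1) (fun i n => c i (n + 1) - c i n) := hc.2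

/-- A family is a symbol as soon as its shift is one and its values at `0` are bounded. -/
lemma of_shift (hc : Symb K m (fun i n => c i (n + 1))) (h0 : ∃ C, ∀ i, |c i 0| ≤ C) :
    Symb K m c := by
  induction K generalizing m c with
  | zero =>
    obtain ⟨C, hC⟩ := hc
    obtain ⟨C', hC'⟩ := h0
    refine ⟨max (2 ^ m * C) C', fun i n => ?_⟩
    cases n with
    | zero => simpa using Or.inr (hC' i)
    | succ n =>
      refine le_max_of_le_left ?_
      calc (((n + 1 : ℕ) : ℝ) + 1) ^ m * |c i (n + 1)|
          ≤ (2 * ((n : ℝ) + 1)) ^ m * |c i (n + 1)| := by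
            gcongr; push_cast; linarith [(Nat.cast_nonneg n : (0 : ℝ) ≤ n)]
        _ = 2 ^ m * (((n : ℝ) + 1) ^ m * |c i (n + 1)|) := by rw [mul_pow]; ring
        _ ≤ 2 ^ m * C := by gcongr; exact hC i n
  | succ K ih =>
    refine ⟨(ih (pred hc) h0).bounded, ih hc.2 ?_⟩
    obtain ⟨C, hC⟩ := hc.bounded
    obtain ⟨C', hC'⟩ := h0
    refine ⟨C + C', fun i => ?_⟩
    have := hC i 0
    simp only [Nat.cast_zero, zero_add, one_pow, one_mul] at this
    exact (abs_sub _ _).trans (add_le_add this (hC' i))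

/-- For ℓ(n) = 2n + d + 1, the difference of 1/ℓ is -2 times the product of 1/ℓ with its shift, so
the induction feeds on `mul`. -/
lemma inv_linear (d : ℕ) :
    Symb K 1 (fun (_ : ι) (n : ℕ) => (2 * (n : ℝ) + d + 1)⁻¹) := by
  induction K with
  | zero =>
    refine ⟨1, fun _ n => ?_⟩
    rw [abs_of_nonneg (by positivity), pow_one, ← div_eq_mul_inv, div_le_one (by positivity)]
    have : (0 : ℝ) ≤ n := Nat.cast_nonneg n
    have : (0 : ℝ) ≤ d := Nat.cast_nonneg d
    linarith
  | succ K ih =>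
    refine ⟨ih.bounded, ?_⟩
    have := ((ih.mul ih.shift).const_mul (-2))
    convert this using 3 with _ n
    have h1 : 2 * (n : ℝ) + d + 1 ≠ 0 := by positivity
    have h2 : 2 * ((n + 1 : ℕ) : ℝ) + d + 1 ≠ 0 := by positivity
    field_simp
    push_cast
    ring

end Symb

/-- The action of multiplication by `1 - τ` on the coefficients of `∑ c_n Z_n(τ)`. -/
noncomputable def diffOp (d : ℕ) (c : ℕ → ℝ) : ℕ → ℝ
  | 0 => c 0 - c 1
  | n + 1 => c (n + 1) - ((n : ℝ) + 1) / (2 * n + d + 1) * c n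
      - ((n : ℝ) + d) / (2 * n + d + 1) * c (n + 2)

namespace Symb

variable {ι : Type*} {K m : ℕ} {c : ι → ℕ → ℝ}

/-- At index n + 1 the operator equals -½ Δ²c_n - ((d - 1)/2) (Δc_n + Δc_{n+1}) / (2n + d + 1):
either a second difference, or a first difference times a symbol of order -1. Index 0 follows
another formula and is treated by `of_shift`. -/
lemma diffOp (d : ℕ) (hc : Symb (K + 2) m c) : Symb K (m + 2) (fun i => diffOp d (c i)) := by
  apply of_shift
  · have h1 : Symb (K + 1) (m + 1) _ := hc.delta
    have h2 := (h1.delta).const_mul (-1 / 2)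
    have h3 := ((h1.pred.add h1.pred.shift).mul (inv_linear (K := K) d)).const_mul
      (-((d : ℝ) - 1) / 2)
    have := h2.add h3
    convert this using 3 with i n
    have h1 : 2 * (n : ℝ) + d + 1 ≠ 0 := by positivity
    simp only [SphBesov.diffOp]
    field_simp
    ring
  · obtain ⟨C, hC⟩ := hc.bounded
    refine ⟨2 ^ m * C + C, fun i => (abs_sub _ _).trans ?_⟩
    have h0 := hC i 0
    have h1 := hC i 1
    norm_num at h0 h1
    have hle : |c i 1| ≤ 2 ^ m * |c i 1| :=
      le_mul_of_one_le_left (abs_nonneg _) (one_le_pow₀ (by norm_num))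
    have hC0 : 0 ≤ C := (abs_nonneg _).trans h0
    have : C ≤ 2 ^ m * C := le_mul_of_one_le_left hC0 (one_le_pow₀ (by norm_num))
    linarith

lemma diffOp_iterate (d M : ℕ) (hc : Symb (K + 2 * M) m c) :
    Symb K (m + 2 * M) (fun i => (SphBesov.diffOp d)^[M] (c i)) := by
  induction M generalizing m c with
  | zero => simpa using hc
  | succ M ih =>
    have h1 : Symb (K + 2 * M + 2) m c := by rwa [show K + 2 * M + 2 = K + 2 * (M + 1) by ring]
    have := ih (h1.diffOp d)
    rw [show m + 2 * (M + 1) = m + 2 + 2 * M by ring]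
    simpa only [Function.iterate_succ_apply] using this

end Symb

/-- By the mean value theorem the innermost difference trades one derivative for a factor h. -/
lemma abs_fwdDiff_iterate_le {k : ℕ} {φ : ℝ → ℝ} (hφ : ContDiff ℝ ∞ φ) {B : ℝ}
    (hB : ∀ t, |iteratedDeriv k φ t| ≤ B) {h : ℝ} (hh : 0 ≤ h) (t : ℝ) :
    |(fwdDiff h)^[k] φ t| ≤ h ^ k * B := by
  induction k generalizing φ B t with
  | zero => simpa using hB t
  | succ k ih =>
    rw [Function.iterate_succ_apply]
    have hs : ContDiff ℝ ∞ (fun s => φ (s + h)) := hφ.comp (contDiff_id.add contDiff_const)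
    have hd : ContDiff ℝ ∞ (fwdDiff h φ) := hs.sub hφ
    have key : ∀ s, |iteratedDeriv k (fwdDiff h φ) s| ≤ B * h := by
      intro s
      have e : iteratedDeriv k (fwdDiff h φ) s = iteratedDeriv k φ (s + h) - iteratedDeriv k φ s := by
        change iteratedDeriv k (fun s => φ (s + h) - φ s) s = _
        rw [iteratedDeriv_fun_sub (hs.contDiffAt.of_le (by exact_mod_cast le_top))
          (hφ.contDiffAt.of_le (by exact_mod_cast le_top)), iteratedDeriv_comp_add_const]
      rw [e]
      have hdiff : Differentiable ℝ (iteratedDeriv k φ) :=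
        hφ.differentiable_iteratedDeriv k (by exact_mod_cast WithTop.coe_lt_top k)
      have := Convex.norm_image_sub_le_of_norm_deriv_le (f := iteratedDeriv k φ) (C := B)
        (s := Set.univ) (x := s) (y := s + h) (fun x _ => hdiff x)
        (fun x _ => by rw [← iteratedDeriv_succ]; exact hB x) convex_univ trivial trivial
      simpa [abs_of_nonneg hh] using this
    calc _ ≤ h ^ k * (B * h) := ih hd key t
      _ = _ := by ring

lemma fwdDiff_iterate_eq_zero {k : ℕ} {φ : ℝ → ℝ} {R h : ℝ} (hh : 0 ≤ h)
    (hφ : ∀ t, R < t → φ t = 0) {t : ℝ} (ht : R < t) : (fwdDiff h)^[k] φ t = 0 := by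
  induction k generalizing φ with
  | zero => simpa using hφ t ht
  | succ k ih =>
    rw [Function.iterate_succ_apply]
    refine ih fun s hs => ?_
    rw [fwdDiff, hφ s hs, hφ (s + h) (by linarith), sub_zero]

/-- Samples of a smooth compactly supported function on finer and finer grids form a family of
symbols of order `0`. -/
lemma symb_sample {a : ℝ → ℝ} (ha : IsCutoff a) (K : ℕ) :
    Symb K 0 (fun (j n : ℕ) => a ((2 : ℝ) ^ (-(j : ℤ)) * (n : ℝ))) := by
  -- A difference in n is a forward difference of `a` with step 2^(-j), so the induction on the
  -- depth must run over all iterated differences at once.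
  suffices H : ∀ m, Symb K m
      (fun (j n : ℕ) => (fwdDiff ((2 : ℝ) ^ (-(j : ℤ))))^[m] a ((2 : ℝ) ^ (-(j : ℤ)) * (n : ℝ))) by
    simpa using H 0
  have hR : ∀ t, 2 < t → a t = 0 := fun t ht =>
    image_eq_zero_of_notMem_tsupport fun hmem => absurd (ha.supp hmem).2 (not_le.2 ht)
  have hcs : HasCompactSupport a := isCompact_Icc.of_isClosed_subset (isClosed_tsupport a) ha.supp
  have hbd : ∀ m, ∃ C, ∀ j n : ℕ, ((n : ℝ) + 1) ^ m *
      |(fwdDiff ((2 : ℝ) ^ (-(j : ℤ))))^[m] a ((2 : ℝ) ^ (-(j : ℤ)) * (n : ℝ))| ≤ C := by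
    intro m
    obtain ⟨B, hB⟩ : ∃ B, ∀ t, |iteratedDeriv m a t| ≤ B := by
      have hc : HasCompactSupport (iteratedDeriv m a) := by
        have := hcs.iteratedFDeriv (𝕜 := ℝ) m
        rw [iteratedDeriv_eq_equiv_comp]
        exact this.comp_left (map_zero _)
      exact hc.exists_bound_of_continuous
        (ha.smooth.continuous_iteratedDeriv m (by exact_mod_cast le_top))
    have hB0 : 0 ≤ B := (abs_nonneg _).trans (hB 0)
    -- With h = 2^(-j) ≤ 1, either hn > 2 and everything vanishes, or h(n + 1) ≤ 3.
    refine ⟨3 ^ m * B, fun j n => ?_⟩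
    set h : ℝ := (2 : ℝ) ^ (-(j : ℤ)) with hh
    have hpos : 0 < h := by positivity
    have hle : h ≤ 1 := by
      rw [hh, zpow_neg, zpow_natCast]
      exact inv_le_one_of_one_le₀ (one_le_pow₀ (by norm_num))
    rcases lt_or_ge 2 (h * n) with hn | hn
    · rw [fwdDiff_iterate_eq_zero hpos.le hR hn]
      simp only [abs_zero, mul_zero]
      positivity
    · calc ((n : ℝ) + 1) ^ m * |(fwdDiff h)^[m] a (h * n)|
          ≤ ((n : ℝ) + 1) ^ m * (h ^ m * B) := by
            gcongr
            exact abs_fwdDiff_iterate_le ha.smooth hB hpos.le _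
        _ = (h * n + h) ^ m * B := by rw [← mul_assoc, ← mul_pow]; ring
        _ ≤ 3 ^ m * B := by gcongr; linarith
  induction K with
  | zero => exact hbd
  | succ K ih =>
    refine fun m => ⟨hbd m, ?_⟩
    convert ih (m + 1) using 3 with j n
    simp only [Function.iterate_succ_apply', fwdDiff, Nat.cast_succ, mul_add, mul_one]

end SphBesov

/-! ### Zonal harmonics: explicit coefficients and recurrences -/

noncomputable section

namespace SphBesov

/-- `1 / (n - m)!`, extended by `0` to `m > n`. -/
def invFact (n m : ℕ) : ℝ := if m ≤ n then ((n - m).factorial : ℝ)⁻¹ else 0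

lemma invFact_succ_succ (n m : ℕ) : invFact (n + 1) (m + 1) = invFact n m := by
  simp [invFact]

/-- The extension by zero keeps this valid for all m; at m = n + 1 the linear factor vanishes.
Coefficient identities then need no case m ≤ n. -/
lemma invFact_succ_left (n m : ℕ) : invFact n m = ((n : ℝ) + 1 - m) * invFact (n + 1) m := by
  unfold invFact
  rcases lt_trichotomy m (n + 1) with h | h | h
  · have h' : m ≤ n := by omega
    rw [if_pos h', if_pos (by omega), show n + 1 - m = n - m + 1 by omega, Nat.factorial_succ]
    have : (n : ℝ) + 1 - m = ((n - m + 1 : ℕ) : ℝ) := by push_cast [h']; ring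
    rw [this]
    have h1 : ((n - m + 1 : ℕ) : ℝ) ≠ 0 := by positivity
    have h2 : ((n - m).factorial : ℝ) ≠ 0 := by positivity
    push_cast at h1 ⊢
    field_simp
  · subst h
    simp
  · rw [if_neg (by omega), if_neg (by omega), mul_zero]

lemma invFact_of_lt {n m : ℕ} (h : n < m) : invFact n m = 0 := if_neg (by omega)

/-- The weights `Γ(d/2) / (Γ(d) m! Γ(m + d/2))`. -/
def zonalWeight (d m : ℕ) : ℝ :=
  Real.Gamma ((d : ℝ) / 2) / (Real.Gamma d * m.factorial * Real.Gamma ((d : ℝ) / 2 + m))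

lemma zonalWeight_succ {d : ℕ} (hd : 1 ≤ d) (m : ℕ) :
    zonalWeight d m = ((m : ℝ) + 1) * ((d : ℝ) / 2 + m) * zonalWeight d (m + 1) := by
  have hd' : (0 : ℝ) < d := by exact_mod_cast hd
  have h1 : (d : ℝ) / 2 + m ≠ 0 := by positivity
  have h2 : Real.Gamma ((d : ℝ) / 2 + m) ≠ 0 := (Real.Gamma_pos_of_pos (by positivity)).ne'
  have h3 : Real.Gamma (d : ℝ) ≠ 0 := (Real.Gamma_pos_of_pos (by positivity)).ne'
  have h4 : Real.Gamma ((d : ℝ) / 2 + (m + 1 : ℕ)) =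
      ((d : ℝ) / 2 + m) * Real.Gamma ((d : ℝ) / 2 + m) := by
    rw [← Real.Gamma_add_one h1]; push_cast; ring_nf
  have h5 : (m.factorial : ℝ) ≠ 0 := by positivity
  have h6 : (m : ℝ) + 1 ≠ 0 := by positivity
  unfold zonalWeight
  rw [h4, Nat.factorial_succ]
  push_cast
  field_simp

/-- The coefficients of `Z_n(1 - 2u)` as a polynomial in `u`. -/
def zonalCoeff (d : ℕ) : ℕ → ℕ → ℝ
  | 0, m => if m = 0 then 1 else 0
  | k + 1, m => (-1) ^ m * (2 * k + d + 1) * zonalWeight d m * (k + m + (d - 1)).factorial *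
      invFact (k + 1) m

lemma zonalCoeff_of_lt {d n m : ℕ} (h : n < m) : zonalCoeff d n m = 0 := by
  cases n with
  | zero => simp [zonalCoeff]; omega
  | succ k => simp [zonalCoeff, invFact_of_lt h]

lemma Gamma_add_natCast {x : ℝ} (hx : 0 < x) (k : ℕ) :
    Real.Gamma (x + k) = (ascPochhammer ℝ k).eval x * Real.Gamma x := by
  induction k with
  | zero => simp
  | succ k ih =>
    rw [ascPochhammer_succ_eval, Nat.cast_succ, ← add_assoc,
      Real.Gamma_add_one (by positivity), ih]
    ring

/-- The Pochhammer factor (d/2 + m)_{n-m} cancels against Γ(n + d/2) and leaves Γ(d/2 + m); the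
other one merges with Γ(d + n - 1) into a factorial. The free range R lets harmonics of different
degrees be compared termwise. -/
lemma zonal_eq_sum {d : ℕ} (hd : 1 ≤ d) {n R : ℕ} (hR : n < R) (u : ℝ) :
    zonal d n (1 - 2 * u) = ∑ m ∈ Finset.range R, zonalCoeff d n m * u ^ m := by
  have hsub : ∑ m ∈ Finset.range R, zonalCoeff d n m * u ^ m =
      ∑ m ∈ Finset.range (n + 1), zonalCoeff d n m * u ^ m := by
    symm
    apply Finset.sum_subset (Finset.range_mono hR)
    intro m _ hm
    rw [zonalCoeff_of_lt (by simpa using hm), zero_mul]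
  rw [hsub]
  obtain ⟨e, rfl⟩ : ∃ e, d = e + 1 := ⟨d - 1, by omega⟩
  cases n with
  | zero => simp [zonal, zonalCoeff]
  | succ k =>
    unfold zonal jacobiP
    rw [if_neg (Nat.succ_ne_zero k), Finset.mul_sum, Finset.mul_sum]
    refine Finset.sum_congr rfl fun m hm => ?_
    have hm' : m ≤ k + 1 := by simpa [Nat.lt_succ_iff] using hm
    have hx : (0 : ℝ) < ((e + 1 : ℕ) : ℝ) / 2 + m := by positivity
    have hG := Gamma_add_natCast hx (k + 1 - m)
    have e1 : ((e + 1 : ℕ) : ℝ) / 2 + m + (k + 1 - m : ℕ) = (k + 1 : ℕ) + ((e + 1 : ℕ) : ℝ) / 2 := by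
      push_cast [hm']; ring
    rw [e1] at hG
    have e2 : (((e + 1 : ℕ) : ℝ) - 2) / 2 + m + 1 = ((e + 1 : ℕ) : ℝ) / 2 + m := by ring
    have e3 : ((k + 1 : ℕ) : ℝ) + (((e + 1 : ℕ) : ℝ) - 2) / 2 + (((e + 1 : ℕ) : ℝ) - 2) / 2 + 1
        = ((k + e + 1 : ℕ) : ℝ) := by push_cast; ring
    have e4 : ((e + 1 : ℕ) : ℝ) + (k + 1 : ℕ) - 1 = ((k + e : ℕ) : ℝ) + 1 := by push_cast; ring
    have e5 : (1 - 2 * u - 1) / 2 = -u := by ring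
    rw [e2, e3, e4, e5, Real.Gamma_nat_eq_factorial, ascPochhammer_nat_eq_natCast_ascFactorial, hG]
    have hf := congrArg (Nat.cast : ℕ → ℝ) (Nat.factorial_mul_ascFactorial (k + e) m)
    push_cast at hf
    have hP : (ascPochhammer ℝ (k + 1 - m)).eval (((e + 1 : ℕ) : ℝ) / 2 + m) ≠ 0 :=
      (ascPochhammer_pos _ _ hx).ne'
    have hG2 : Real.Gamma (((e + 1 : ℕ) : ℝ) / 2 + m) ≠ 0 := (Real.Gamma_pos_of_pos hx).ne'
    have hG3 : Real.Gamma ((e + 1 : ℕ) : ℝ) ≠ 0 := (Real.Gamma_pos_of_pos (by positivity)).ne'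
    simp only [zonalCoeff, zonalWeight, invFact, if_pos hm', Nat.add_sub_cancel]
    rw [show k + m + e = k + e + m by ring, ← hf, Nat.cast_choose ℝ hm', neg_pow u m]
    generalize (ascPochhammer ℝ (k + 1 - m)).eval (((e + 1 : ℕ) : ℝ) / 2 + m) = P at hP ⊢
    have f1 : ((k + 1).factorial : ℝ) ≠ 0 := by positivity
    have f2 : (m.factorial : ℝ) ≠ 0 := by positivity
    have f3 : ((k + 1 - m).factorial : ℝ) ≠ 0 := by positivity
    field_simp
    push_cast
    ring

lemma factorial_succ_cast (n : ℕ) : ((n + 1).factorial : ℝ) = ((n : ℝ) + 1) * n.factorial := by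
  rw [Nat.factorial_succ]; push_cast; ring

/-- The coefficients of the recurrence `τ Z_{n+1} = ⋯ + b_n Z_n`. -/
def recB (d : ℕ) : ℕ → ℝ
  | 0 => 1
  | k + 1 => ((k : ℝ) + d) / (2 * k + d + 1)

/-- The coefficients of the recurrence `τ Z_n = a_n Z_{n+1} + ⋯`. -/
def recA (d n : ℕ) : ℝ := ((n : ℝ) + 1) / (2 * n + d + 1)

lemma zonalWeight_zero_mul_factorial (e : ℕ) : zonalWeight (e + 1) 0 * e.factorial = 1 := by
  have h2 : Real.Gamma (((e + 1 : ℕ) : ℝ) / 2) ≠ 0 := (Real.Gamma_pos_of_pos (by positivity)).ne'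
  have f1 : (e.factorial : ℝ) ≠ 0 := by positivity
  have h3 : Real.Gamma ((e + 1 : ℕ) : ℝ) = e.factorial := by
    rw [← Real.Gamma_nat_eq_factorial]; push_cast; rfl
  simp only [zonalWeight, h3, Nat.factorial_zero, Nat.cast_zero, add_zero, Nat.cast_one, mul_one]
  field_simp

lemma zonalCoeff_zero_rec {d : ℕ} (hd : 1 ≤ d) (n : ℕ) :
    zonalCoeff d (n + 1) 0 = recA d (n + 1) * zonalCoeff d (n + 2) 0 + recB d n * zonalCoeff d n 0 := by
  obtain ⟨e, rfl⟩ : ∃ e, d = e + 1 := ⟨d - 1, by omega⟩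
  cases n with
  | zero =>
    simp only [zonalCoeff, recA, recB, if_true, pow_zero, Nat.add_sub_cancel]
    have hw := zonalWeight_zero_mul_factorial e
    rw [show 0 + 1 + 0 + e = e + 1 by ring, show 0 + 0 + e = e by ring, factorial_succ_cast,
      invFact_succ_left (0 + 1) 0]
    have : invFact (0 + 1 + 1) 0 = 1 / 2 := by norm_num [invFact]
    rw [this]
    push_cast
    field_simp
    linear_combination 2 * hw
  | succ k =>
    simp only [zonalCoeff, recA, recB, pow_zero, Nat.add_sub_cancel]
    rw [invFact_succ_left (k + 1) 0, invFact_succ_left (k + 1 + 1) 0,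
      show k + 1 + 1 + 0 + e = k + e + 1 + 1 by ring, show k + 1 + 0 + e = k + e + 1 by ring,
      show k + 0 + e = k + e by ring, Nat.add_zero]
    simp only [factorial_succ_cast]
    push_cast
    field_simp
    ring

lemma zonalCoeff_succ_rec {d : ℕ} (hd : 1 ≤ d) (n p : ℕ) :
    zonalCoeff d (n + 1) (p + 1) - 2 * zonalCoeff d (n + 1) p =
      recA d (n + 1) * zonalCoeff d (n + 2) (p + 1) + recB d n * zonalCoeff d n (p + 1) := by
  have hw := zonalWeight_succ hd p
  obtain ⟨e, rfl⟩ : ∃ e, d = e + 1 := ⟨d - 1, by omega⟩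
  cases n with
  | zero =>
    simp only [zonalCoeff, recA, recB, Nat.add_sub_cancel]
    rw [if_neg (Nat.succ_ne_zero p), hw, ← invFact_succ_succ (0 + 1) p,
      invFact_succ_left (0 + 1) (p + 1),
      show 0 + 1 + (p + 1) + e = p + e + 1 + 1 by ring, show 0 + (p + 1) + e = p + e + 1 by ring,
      show 0 + p + e = p + e by ring, pow_succ]
    simp only [factorial_succ_cast]
    -- Here Z_0 contributes nothing in degree p + 1. What remains is a multiple of p(1 - p)/(1 -
    -- p)!, zero by a factor for p ≤ 1 and by the convention of `invFact` beyond.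
    have h0 : ((1 : ℝ) - p) * (p * invFact (0 + 1 + 1) (p + 1)) = 0 := by
      rcases lt_trichotomy p 1 with h | h | h
      · interval_cases p; simp
      · subst h; simp
      · rw [invFact_of_lt (by omega)]; simp
    push_cast
    field_simp
    linear_combination e * zonalWeight (e + 1) (p + 1) * (p + e).factorial * (-1) ^ p * h0
  | succ k =>
    simp only [zonalCoeff, recA, recB, Nat.add_sub_cancel]
    rw [hw, ← invFact_succ_succ (k + 1 + 1) p, invFact_succ_left (k + 1) (p + 1),
      invFact_succ_left (k + 1 + 1) (p + 1),
      show k + 1 + 1 + (p + 1) + e = k + p + e + 1 + 1 + 1 by ring,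
      show k + 1 + (p + 1) + e = k + p + e + 1 + 1 by ring,
      show k + (p + 1) + e = k + p + e + 1 by ring,
      show k + 1 + p + e = k + p + e + 1 by ring, pow_succ]
    simp only [factorial_succ_cast]
    push_cast
    field_simp
    ring

/-- Comparison of coefficients in u = (1 - t)/2. This identity drives both the action of 1 - τ on
coefficients and the orthogonality relations. -/
lemma zonal_rec {d : ℕ} (hd : 1 ≤ d) (n : ℕ) (t : ℝ) :
    t * zonal d (n + 1) t = recA d (n + 1) * zonal d (n + 2) t + recB d n * zonal d n t := by
  obtain ⟨u, rfl⟩ : ∃ u, t = 1 - 2 * u := ⟨(1 - t) / 2, by ring⟩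
  have hs : zonal d (n + 1) (1 - 2 * u) =
      ∑ m ∈ Finset.range (n + 3), zonalCoeff d (n + 1) (m + 1) * u ^ (m + 1) +
        zonalCoeff d (n + 1) 0 := by
    rw [zonal_eq_sum hd (show n + 1 < n + 3 + 1 by omega), Finset.sum_range_succ', pow_zero, mul_one]
  have hs' : zonal d (n + 1) (1 - 2 * u) =
      ∑ m ∈ Finset.range (n + 3), zonalCoeff d (n + 1) m * u ^ m :=
    zonal_eq_sum hd (by omega) u
  have hL : (1 - 2 * u) * zonal d (n + 1) (1 - 2 * u) = zonalCoeff d (n + 1) 0 +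
      ∑ m ∈ Finset.range (n + 3),
        (zonalCoeff d (n + 1) (m + 1) - 2 * zonalCoeff d (n + 1) m) * u ^ (m + 1) := by
    have : ∑ m ∈ Finset.range (n + 3),
        (zonalCoeff d (n + 1) (m + 1) - 2 * zonalCoeff d (n + 1) m) * u ^ (m + 1) =
        ∑ m ∈ Finset.range (n + 3), zonalCoeff d (n + 1) (m + 1) * u ^ (m + 1) -
        2 * u * ∑ m ∈ Finset.range (n + 3), zonalCoeff d (n + 1) m * u ^ m := by
      rw [Finset.mul_sum, ← Finset.sum_sub_distrib]
      exact Finset.sum_congr rfl fun m _ => by ring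
    rw [this]
    linear_combination hs - 2 * u * hs'
  rw [hL, zonal_eq_sum hd (show n + 2 < n + 3 + 1 by omega),
    zonal_eq_sum hd (show n < n + 3 + 1 by omega), Finset.sum_range_succ' _ (n + 3),
    Finset.sum_range_succ' _ (n + 3),
    zonalCoeff_zero_rec hd, mul_add (recA d (n + 1)), mul_add (recB d n), Finset.mul_sum, Finset.mul_sum]
  have : ∑ m ∈ Finset.range (n + 3),
      (zonalCoeff d (n + 1) (m + 1) - 2 * zonalCoeff d (n + 1) m) * u ^ (m + 1) =
      ∑ m ∈ Finset.range (n + 3), recA d (n + 1) * (zonalCoeff d (n + 2) (m + 1) * u ^ (m + 1)) +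
      ∑ m ∈ Finset.range (n + 3), recB d n * (zonalCoeff d n (m + 1) * u ^ (m + 1)) := by
    rw [← Finset.sum_add_distrib]
    refine Finset.sum_congr rfl fun m _ => ?_
    rw [zonalCoeff_succ_rec hd]
    ring
  rw [this]
  ring

lemma zonal_rec_zero {d : ℕ} (hd : 1 ≤ d) (t : ℝ) :
    t * zonal d 0 t = recA d 0 * zonal d 1 t := by
  obtain ⟨u, rfl⟩ : ∃ u, t = 1 - 2 * u := ⟨(1 - t) / 2, by ring⟩
  rw [zonal_eq_sum hd (show 1 < 2 by omega)]
  have hw := zonalWeight_succ hd 0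
  obtain ⟨e, rfl⟩ : ∃ e, d = e + 1 := ⟨d - 1, by omega⟩
  have h0 := zonalWeight_zero_mul_factorial e
  have h1 : invFact 1 0 = 1 := by norm_num [invFact]
  have h2 : invFact 1 1 = 1 := by norm_num [invFact]
  simp only [Finset.sum_range_succ, Finset.sum_range_zero, zonal, if_true, zonalCoeff, recA,
    zero_add, h1, h2, Nat.add_sub_cancel]
  rw [show 1 + e = e + 1 by ring, factorial_succ_cast]
  rw [hw] at h0 ⊢
  push_cast at h0 ⊢
  field_simp at h0 ⊢
  linear_combination (2 * u - 1) * h0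

/-- The coefficient form of the hypergeometric equation satisfied by Z_{n+1}. -/
lemma zonalCoeff_ode {d : ℕ} (hd : 1 ≤ d) (n m : ℕ) :
    ((m : ℝ) + 1) * (m + d / 2) * zonalCoeff d (n + 1) (m + 1) =
      -(((n : ℝ) + 1 - m) * (n + m + d)) * zonalCoeff d (n + 1) m := by
  have hw := zonalWeight_succ hd m
  obtain ⟨e, rfl⟩ : ∃ e, d = e + 1 := ⟨d - 1, by omega⟩
  simp only [zonalCoeff, Nat.add_sub_cancel]
  rw [hw, invFact_succ_succ, invFact_succ_left n m, show n + (m + 1) + e = n + m + e + 1 by ring,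
    factorial_succ_cast, pow_succ]
  push_cast
  ring

/-- Rearrangement of the three-term recurrence; the last two terms come from truncating the sum and
disappear when c vanishes from R on. -/
lemma sum_diffOp {d : ℕ} (hd : 1 ≤ d) (c : ℕ → ℝ) (t : ℝ) (R : ℕ) :
    (1 - t) * ∑ n ∈ Finset.range (R + 1), c n * zonal d n t =
      ∑ n ∈ Finset.range (R + 1), diffOp d c n * zonal d n t
        - recA d R * c R * zonal d (R + 1) t + recB d R * c (R + 1) * zonal d R t := by
  induction R with
  | zero =>
    have := zonal_rec_zero hd t
    simp only [zero_add, Finset.sum_range_one, diffOp, recB]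
    linear_combination (-c 0) * this
  | succ R ih =>
    rw [Finset.sum_range_succ, mul_add, ih, Finset.sum_range_succ _ (R + 1)]
    have := zonal_rec hd R t
    simp only [diffOp]
    have hB : recB d (R + 1) = ((R : ℝ) + d) / (2 * R + d + 1) := rfl
    have hA : recA d R = ((R : ℝ) + 1) / (2 * R + d + 1) := rfl
    rw [← hB, ← hA]
    linear_combination (-c (R + 1)) * this

lemma diffOp_eq_zero {d R : ℕ} {c : ℕ → ℝ} (hc : ∀ n, R ≤ n → c n = 0) {n : ℕ} (hn : R + 1 ≤ n) :
    diffOp d c n = 0 := by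
  obtain ⟨k, rfl⟩ : ∃ k, n = k + 1 := ⟨n - 1, by omega⟩
  simp [diffOp, hc (k + 1) (by omega), hc k (by omega), hc (k + 2) (by omega)]

lemma diffOp_iterate_eq_zero {d R : ℕ} {c : ℕ → ℝ} (hc : ∀ n, R ≤ n → c n = 0) (M : ℕ) {n : ℕ}
    (hn : R + M ≤ n) : (diffOp d)^[M] c n = 0 := by
  induction M generalizing n with
  | zero => exact hc n hn
  | succ M ih =>
    rw [Function.iterate_succ_apply']
    exact diffOp_eq_zero (fun k hk => ih hk) (by omega)

/-- Each application spreads the support by one index. Hence the coefficients still live on n ≳ 2^i,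
where decay in n is decay in 2^i. -/
lemma diffOp_iterate_eq_zero_of_add_le {d R : ℕ} {c : ℕ → ℝ} (hc : ∀ n, n < R → c n = 0) (M : ℕ)
    {n : ℕ} (hn : n + M < R) : (diffOp d)^[M] c n = 0 := by
  induction M generalizing n with
  | zero => exact hc n hn
  | succ M ih =>
    rw [Function.iterate_succ_apply']
    cases n with
    | zero => simp [diffOp, ih (n := 0) (by omega), ih (n := 1) (by omega)]
    | succ n =>
      simp [diffOp, ih (n := n + 1) (by omega), ih (n := n) (by omega), ih (n := n + 2) (by omega)]

lemma pow_mul_sum_zonal {d : ℕ} (hd : 1 ≤ d) {c : ℕ → ℝ} {R : ℕ} (hc : ∀ n, R ≤ n → c n = 0)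
    (M : ℕ) (t : ℝ) :
    (1 - t) ^ M * ∑ n ∈ Finset.range R, c n * zonal d n t =
      ∑ n ∈ Finset.range (R + M), (diffOp d)^[M] c n * zonal d n t := by
  induction M with
  | zero => simp
  | succ M ih =>
    have h0 : ∀ n, R + M ≤ n → (diffOp d)^[M] c n = 0 := fun n hn => diffOp_iterate_eq_zero hc M hn
    have := sum_diffOp hd ((diffOp d)^[M] c) t (R + M)
    rw [Finset.sum_range_succ, h0 (R + M) le_rfl, h0 (R + M + 1) (by omega)] at this
    rw [pow_succ', mul_assoc, ih]
    simp only [Function.iterate_succ_apply']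
    simpa [add_assoc] using this

end SphBesov

end

/-! ### Moments of the surface measure -/

noncomputable section

namespace SphBesov

section Gaussian

variable {d : ℕ}

local notation "E" => EuclideanSpace ℝ (Fin (d + 1))

/-- In polar coordinates the integrand splits into an angular and a radial factor, the latter giving
the Gamma value. Spherical moments can then be computed in flat space. -/
lemma integral_inner_pow_mul_gaussian (v : E) (k : ℕ) :
    ∫ y : E, inner ℝ v y ^ k * Real.exp (-‖y‖ ^ 2) =
      (∫ y : Sph d, inner ℝ v (y : E) ^ k ∂(volume : Measure E).toSphere) *
        (1 / 2 * Real.Gamma (((d : ℝ) + k + 1) / 2)) := by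
  have hmp := (volume : Measure E).measurePreserving_homeomorphUnitSphereProd
  set G : Set.Ioi (0 : ℝ) → ℝ := fun r => (r : ℝ) ^ k * Real.exp (-(r : ℝ) ^ 2) with hG
  have h1 : ∫ y : E, inner ℝ v y ^ k * Real.exp (-‖y‖ ^ 2) =
      ∫ y : ({0}ᶜ : Set E), inner ℝ v (y : E) ^ k * Real.exp (-‖(y : E)‖ ^ 2)
        ∂(volume.comap Subtype.val) := by
    rw [integral_subtype_comap (measurableSet_singleton _).compl
      (fun y : E => inner ℝ v y ^ k * Real.exp (-‖y‖ ^ 2)), restrict_compl_singleton]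
  have h2 : ∫ y : ({0}ᶜ : Set E), inner ℝ v (y : E) ^ k * Real.exp (-‖(y : E)‖ ^ 2)
        ∂(volume.comap Subtype.val) =
      ∫ z : Sph d × Set.Ioi (0 : ℝ), inner ℝ v (z.1 : E) ^ k * G z.2
        ∂((volume : Measure E).toSphere.prod (Measure.volumeIoiPow (Module.finrank ℝ E - 1))) := by
    rw [← hmp.integral_comp (Homeomorph.measurableEmbedding _)]
    refine integral_congr_ae (Eventually.of_forall fun y => ?_)
    have hy : ‖(y : E)‖ ≠ 0 := norm_ne_zero_iff.2 y.2
    simp only [hG, homeomorphUnitSphereProd_apply_fst_coe, homeomorphUnitSphereProd_apply_snd_coe,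
      inner_smul_right, mul_pow, inv_pow]
    field_simp
  have h3 : ∫ r : Set.Ioi (0 : ℝ), G r ∂(Measure.volumeIoiPow (Module.finrank ℝ E - 1)) =
      1 / 2 * Real.Gamma (((d : ℝ) + k + 1) / 2) := by
    have hdim : Module.finrank ℝ E - 1 = d := by simp
    rw [hdim, Measure.volumeIoiPow]
    simp only [ENNReal.ofReal]
    rw [integral_withDensity_eq_integral_smul (by fun_prop), hG,
      integral_subtype_comap measurableSet_Ioi
        (fun r : ℝ => Real.toNNReal (r ^ d) • (r ^ k * Real.exp (-r ^ 2)))]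
    have := integral_rpow_mul_exp_neg_rpow (p := 2) (q := (d : ℝ) + k) (by norm_num)
      (by have : (0 : ℝ) ≤ (d : ℝ) + k := by positivity
          linarith)
    rw [← this]
    refine setIntegral_congr_fun measurableSet_Ioi fun r hr => ?_
    have hr0 : (0 : ℝ) < r := hr
    simp only [NNReal.smul_def, smul_eq_mul]
    rw [Real.coe_toNNReal _ (by positivity), Real.rpow_add hr0, Real.rpow_natCast,
      Real.rpow_natCast, Real.rpow_two]
    ring
  rw [h1, h2, integral_prod_mul (fun y : Sph d => inner ℝ v (y : E) ^ k) G, h3]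

lemma integrable_inner_pow_mul_gaussian (v : E) (k : ℕ) :
    Integrable (fun y : E => inner ℝ v y ^ k * Real.exp (-‖y‖ ^ 2)) := by
  have h0 : Integrable (fun y : E => ‖y‖ ^ k * Real.exp (-‖y‖ ^ 2)) := by
    rw [integrable_fun_norm_addHaar volume (f := fun r : ℝ => r ^ k * Real.exp (-r ^ 2))]
    have := integrableOn_rpow_mul_exp_neg_rpow (p := 2) (s := (d : ℝ) + k)
      (by have : (0 : ℝ) ≤ (d : ℝ) + k := by positivity
          linarith) (by norm_num)
    refine this.congr_fun (fun r hr => ?_) measurableSet_Ioi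
    have hr0 : (0 : ℝ) < r := hr
    simp only [smul_eq_mul, finrank_euclideanSpace, Fintype.card_fin, Nat.add_sub_cancel]
    rw [Real.rpow_add hr0, Real.rpow_natCast, Real.rpow_natCast, Real.rpow_two]
    ring
  refine (h0.const_mul (‖v‖ ^ k)).mono' (by fun_prop) (Eventually.of_forall fun y => ?_)
  rw [norm_mul, Real.norm_of_nonneg (Real.exp_pos _).le, norm_pow, ← mul_assoc, ← mul_pow]
  gcongr
  exact norm_inner_le_norm v y

/-- Integration by parts in the direction v. At k = 0 the truncated exponent `k - 1` is harmless
because of the factor k. -/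
lemma gaussian_moment_rec {v : E} (hv : ‖v‖ = 1) (k : ℕ) :
    2 * ∫ y : E, inner ℝ v y ^ (k + 1) * Real.exp (-‖y‖ ^ 2) =
      k * ∫ y : E, inner ℝ v y ^ (k - 1) * Real.exp (-‖y‖ ^ 2) := by
  have hf : ∀ y : E, HasFDerivAt (fun y : E => inner ℝ v y ^ k)
      ((k * inner ℝ v y ^ (k - 1)) • innerSL ℝ v) y := fun y => by
    simpa using ((innerSL ℝ v).hasFDerivAt (x := y)).pow k
  have hg : ∀ y : E, HasFDerivAt (fun y : E => Real.exp (-‖y‖ ^ 2))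
      (Real.exp (-‖y‖ ^ 2) • (-((2 : ℕ) • innerSL ℝ y))) y := fun y => by
    have := ((hasFDerivAt_id y).norm_sq).neg.exp
    simpa using this
  have hfd : ∀ y : E, fderiv ℝ (fun y : E => inner ℝ v y ^ k) y v = k * inner ℝ v y ^ (k - 1) :=
    fun y => by
      rw [(hf y).fderiv]
      simp [hv]
  have hgd : ∀ y : E, fderiv ℝ (fun y : E => Real.exp (-‖y‖ ^ 2)) y v =
      -2 * (inner ℝ v y * Real.exp (-‖y‖ ^ 2)) := fun y => by
    rw [(hg y).fderiv]
    simp [real_inner_comm]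
    ring
  have key := integral_mul_fderiv_eq_neg_fderiv_mul_of_integrable (μ := (volume : Measure E))
    (f := fun y : E => inner ℝ v y ^ k) (g := fun y : E => Real.exp (-‖y‖ ^ 2)) (v := v)
    (by
      simp only [hfd, mul_assoc]
      exact (integrable_inner_pow_mul_gaussian v (k - 1)).const_mul _)
    (by
      simp only [hgd]
      refine ((integrable_inner_pow_mul_gaussian v (k + 1)).const_mul (-2)).congr
        (Eventually.of_forall fun y => ?_)
      simp only
      ring)
    (integrable_inner_pow_mul_gaussian v k)
    (fun y _ => (hf y).differentiableAt) (fun y _ => (hg y).differentiableAt)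
  simp only [hfd, hgd, mul_assoc] at key
  rw [integral_const_mul] at key
  have h2 : ∫ y : E, inner ℝ v y ^ k * (-2 * (inner ℝ v y * Real.exp (-‖y‖ ^ 2))) =
      -2 * ∫ y : E, inner ℝ v y ^ (k + 1) * Real.exp (-‖y‖ ^ 2) := by
    rw [← integral_const_mul]
    refine integral_congr_ae (Eventually.of_forall fun y => ?_)
    simp only
    ring
  rw [h2] at key
  linarith

lemma toSphere_moment_rec {v : E} (hv : ‖v‖ = 1) (k : ℕ) :
    ((k : ℝ) + d) * ∫ y : Sph d, inner ℝ v (y : E) ^ (k + 1) ∂(volume : Measure E).toSphere =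
      k * ∫ y : Sph d, inner ℝ v (y : E) ^ (k - 1) ∂(volume : Measure E).toSphere := by
  have h := gaussian_moment_rec hv k
  rw [integral_inner_pow_mul_gaussian, integral_inner_pow_mul_gaussian] at h
  -- At k = 0 the truncated `k - 1` breaks the Gamma quotient, but the right-hand side is zero.
  -- Otherwise the quotient is (k + d)/2.
  rcases Nat.eq_zero_or_pos k with rfl | hk
  · have hG : 0 < Real.Gamma (((d : ℝ) + (0 + 1 : ℕ) + 1) / 2) :=
      Real.Gamma_pos_of_pos (by positivity)
    simp only [Nat.cast_zero, zero_mul, mul_eq_zero] at h ⊢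
    rcases h with h | h | h | h
    · norm_num at h
    · exact Or.inr h
    · norm_num at h
    · exact absurd h hG.ne'
  · obtain ⟨j, rfl⟩ : ∃ j, k = j + 1 := ⟨k - 1, by omega⟩
    have hp : (0 : ℝ) < ((d : ℝ) + j + 1) / 2 := by positivity
    have hG := Real.Gamma_pos_of_pos hp
    have hG2 : Real.Gamma (((d : ℝ) + (j + 1 + 1 : ℕ) + 1) / 2) =
        ((d : ℝ) + j + 1) / 2 * Real.Gamma (((d : ℝ) + j + 1) / 2) := by
      rw [← Real.Gamma_add_one hp.ne']
      congr 1
      push_cast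
      ring
    rw [hG2, Nat.add_sub_cancel] at h
    rw [Nat.add_sub_cancel]
    refine mul_right_cancel₀ hG.ne' ?_
    push_cast at h ⊢
    linear_combination 2 * h

end Gaussian

instance (d : ℕ) : IsProbabilityMeasure (sphMeasure d) := by
  constructor
  rw [sphMeasure, Measure.smul_apply, smul_eq_mul]
  refine ENNReal.inv_mul_cancel ?_ (measure_ne_top _ _)
  rw [Ne, Measure.measure_univ_eq_zero]
  exact Measure.toSphere_ne_zero _

lemma integrable_of_continuous {d : ℕ} {F : Sph d → ℝ} (hF : Continuous F) :
    Integrable F (sphMeasure d) :=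
  hF.integrable_of_hasCompactSupport (HasCompactSupport.of_compactSpace _)

/-- The inner product `⟨x, y⟩` of two points of the sphere. -/
abbrev sphInner {d : ℕ} (x y : Sph d) : ℝ :=
  inner ℝ (x : EuclideanSpace ℝ (Fin (d + 1))) (y : EuclideanSpace ℝ (Fin (d + 1)))

variable {d : ℕ}

lemma continuous_sphInner (x : Sph d) : Continuous (sphInner x) := by
  unfold sphInner
  fun_prop

lemma sphMeasure_moment_rec (x : Sph d) (k : ℕ) :
    ((k : ℝ) + d) * ∫ y, sphInner x y ^ (k + 1) ∂(sphMeasure d) =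
      k * ∫ y, sphInner x y ^ (k - 1) ∂(sphMeasure d) := by
  have hx : ‖(x : EuclideanSpace ℝ (Fin (d + 1)))‖ = 1 := by simp
  have := toSphere_moment_rec hx k
  unfold sphMeasure
  rw [integral_smul_measure, integral_smul_measure, smul_eq_mul, smul_eq_mul, mul_left_comm, this]
  ring

/-- Integration by parts along the gradient of `⟨x, ·⟩`. -/
lemma integral_polynomial_identity (x : Sph d) (p : Polynomial ℝ) :
    ∫ y, ((1 - sphInner x y ^ 2) * p.derivative.eval (sphInner x y)
      - d * sphInner x y * p.eval (sphInner x y)) ∂(sphMeasure d) = 0 := by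
  have hc := continuous_sphInner x
  induction p using Polynomial.induction_on' with
  | add p q hp hq =>
    simp only [Polynomial.derivative_add, Polynomial.eval_add]
    refine Eq.trans ?_ ((congrArg₂ (· + ·) hp hq).trans (add_zero 0))
    rw [← integral_add]
    · refine integral_congr_ae (Eventually.of_forall fun y => ?_)
      simp only
      ring
    · exact integrable_of_continuous (by fun_prop)
    · exact integrable_of_continuous (by fun_prop)
  | monomial k a =>
    have hrec := sphMeasure_moment_rec x k
    have hpt : ∀ y, (1 - sphInner x y ^ 2) *
        (Polynomial.derivative (Polynomial.monomial k a)).eval (sphInner x y)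
        - d * sphInner x y * (Polynomial.monomial k a).eval (sphInner x y) =
        a * k * sphInner x y ^ (k - 1) - a * (k + d) * sphInner x y ^ (k + 1) := by
      intro y
      rw [Polynomial.derivative_monomial, Polynomial.eval_monomial, Polynomial.eval_monomial]
      cases k with
      | zero => simp; ring
      | succ k => rw [Nat.add_sub_cancel]; ring
    simp only [hpt]
    rw [integral_sub (integrable_of_continuous (by fun_prop))
      (integrable_of_continuous (by fun_prop)), integral_const_mul, integral_const_mul]
    linear_combination (-a) * hrec

/-- The preceding identity for p = w^m with w = (1 - τ)/2, where 1 - τ² = 4w(1 - w) and τ = 1 - 2w.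
-/
lemma integral_one_sub_pow_rec (x : Sph d) (m : ℕ) :
    ((m : ℝ) + d) * ∫ y, ((1 - sphInner x y) / 2) ^ (m + 1) ∂(sphMeasure d) =
      (m + d / 2) * ∫ y, ((1 - sphInner x y) / 2) ^ m ∂(sphMeasure d) := by
  have hc := continuous_sphInner x
  have h := integral_polynomial_identity x
    ((Polynomial.C (1 / 2) * (1 - Polynomial.X)) ^ m)
  have hpt : ∀ y, (1 - sphInner x y ^ 2) * (Polynomial.derivative
        ((Polynomial.C (1 / 2 : ℝ) * (1 - Polynomial.X)) ^ m)).eval (sphInner x y)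
        - d * sphInner x y * ((Polynomial.C (1 / 2 : ℝ) * (1 - Polynomial.X)) ^ m).eval
          (sphInner x y) =
      2 * ((m + d) * ((1 - sphInner x y) / 2) ^ (m + 1)) -
      2 * ((m + d / 2) * ((1 - sphInner x y) / 2) ^ m) := by
    intro y
    rw [Polynomial.derivative_pow]
    simp only [Polynomial.eval_mul, Polynomial.eval_pow, Polynomial.eval_C, Polynomial.eval_sub,
      Polynomial.eval_one, Polynomial.eval_X, Polynomial.derivative_mul, Polynomial.derivative_C,
      Polynomial.derivative_sub, Polynomial.derivative_one, Polynomial.derivative_X,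
      Polynomial.eval_add, Polynomial.eval_zero]
    cases m with
    | zero => simp; ring
    | succ m => rw [Nat.add_sub_cancel]; push_cast; ring
  simp only [hpt] at h
  rw [integral_sub (integrable_of_continuous (by fun_prop))
      (integrable_of_continuous (by fun_prop)), integral_const_mul, integral_const_mul,
      integral_const_mul, integral_const_mul] at h
  linarith

end SphBesov

end

/-! ### Orthogonality and norms of the zonal harmonics -/

noncomputable section

namespace SphBesov

variable {d : ℕ}

lemma continuous_zonal (hd : 1 ≤ d) (n : ℕ) : Continuous (zonal d n) := by
  have : zonal d n = fun t => ∑ m ∈ Finset.range (n + 1), zonalCoeff d n m * ((1 - t) / 2) ^ m := by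
    funext t
    rw [← zonal_eq_sum hd (Nat.lt_succ_self n)]
    congr 1
    ring
  rw [this]
  fun_prop

/-- `∫ Z_n(⟨x, y⟩) dσ(y) = 0` for `n ≥ 1`. -/
lemma integral_zonal_succ (hd : 1 ≤ d) (x : Sph d) (k : ℕ) :
    ∫ y, zonal d (k + 1) (sphInner x y) ∂(sphMeasure d) = 0 := by
  have hc := continuous_sphInner x
  set S : ℕ → ℝ := fun m => ∫ y, ((1 - sphInner x y) / 2) ^ m ∂(sphMeasure d) with hS
  have hrec : ∀ m : ℕ, ((m : ℝ) + d) * S (m + 1) = (m + d / 2) * S m :=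
    integral_one_sub_pow_rec x
  have h1 : ∫ y, zonal d (k + 1) (sphInner x y) ∂(sphMeasure d) =
      ∑ m ∈ Finset.range (k + 2), zonalCoeff d (k + 1) m * S m := by
    have : ∀ y, zonal d (k + 1) (sphInner x y) = ∑ m ∈ Finset.range (k + 2),
        zonalCoeff d (k + 1) m * ((1 - sphInner x y) / 2) ^ m := fun y => by
      rw [← zonal_eq_sum hd (Nat.lt_succ_self (k + 1))]
      congr 1
      ring
    simp only [this]
    rw [integral_finsetSum _ fun m _ => integrable_of_continuous (by fun_prop)]
    simp only [integral_const_mul, hS]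
  -- The coefficient and moment recurrences combine to make the sum telescope after multiplication
  -- by (k + 1)(k + d), the Laplace eigenvalue in degree k + 1. Both ends of the telescope vanish.
  set g : ℕ → ℝ := fun m => m * (m + d - 1) * zonalCoeff d (k + 1) m * S m with hg
  have h2 : ((k : ℝ) + 1) * (k + d) * ∑ m ∈ Finset.range (k + 2), zonalCoeff d (k + 1) m * S m =
      ∑ m ∈ Finset.range (k + 2), (g m - g (m + 1)) := by
    rw [Finset.mul_sum]
    refine Finset.sum_congr rfl fun m _ => ?_
    have e1 := zonalCoeff_ode hd k m
    have e2 := hrec m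
    simp only [hg]
    push_cast
    linear_combination (S m) * e1 + ((m : ℝ) + 1) * zonalCoeff d (k + 1) (m + 1) * e2
  rw [Finset.sum_range_sub'] at h2
  have h3 : g (k + 2) = 0 := by
    simp only [hg]
    rw [zonalCoeff_of_lt (by omega)]
    ring
  have h4 : g 0 = 0 := by simp [hg]
  rw [h3, h4, sub_zero] at h2
  have hd' : (0 : ℝ) < d := by exact_mod_cast hd
  rw [h1]
  exact (mul_eq_zero.1 h2).resolve_left (by positivity)

/-- The integral `∫ Z_n(⟨x, y⟩) Z_m(⟨x, y⟩) dσ(y)`. -/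
def zonalGram (x : Sph d) (n m : ℕ) : ℝ :=
  ∫ y, zonal d n (sphInner x y) * zonal d m (sphInner x y) ∂(sphMeasure d)

lemma zonalGram_comm (x : Sph d) (n m : ℕ) : zonalGram x n m = zonalGram x m n := by
  simp only [zonalGram, mul_comm]

lemma recA_pos (d n : ℕ) : 0 < recA d n := by
  unfold recA
  positivity

lemma integral_mul_zonal_mul (hd : 1 ≤ d) (x : Sph d) (n m : ℕ) :
    ∫ y, sphInner x y * zonal d (n + 1) (sphInner x y) * zonal d m (sphInner x y) ∂(sphMeasure d) =
      recA d (n + 1) * zonalGram x (n + 2) m + recB d n * zonalGram x n m := by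
  have hc := continuous_sphInner x
  have hz := fun n => (continuous_zonal hd n).comp hc
  simp only [zonal_rec hd, add_mul, mul_assoc]
  rw [integral_add, integral_const_mul, integral_const_mul]
  · rfl
  · exact integrable_of_continuous (continuous_const.mul ((hz _).mul (hz _)))
  · exact integrable_of_continuous (continuous_const.mul ((hz _).mul (hz _)))

lemma integral_mul_zonal_zero_mul (hd : 1 ≤ d) (x : Sph d) (m : ℕ) :
    ∫ y, sphInner x y * zonal d 0 (sphInner x y) * zonal d m (sphInner x y) ∂(sphMeasure d) =
      recA d 0 * zonalGram x 1 m := by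
  simp only [zonal_rec_zero hd, mul_assoc]
  rw [integral_const_mul]
  rfl

/-- Multiplication by τ is symmetric: ∫ τ Z_{n+1} Z_{m+1} is expanded on either factor. -/
lemma zonalGram_rec (hd : 1 ≤ d) (x : Sph d) (n m : ℕ) :
    recA d (n + 1) * zonalGram x (n + 2) (m + 1) + recB d n * zonalGram x n (m + 1) =
      recA d (m + 1) * zonalGram x (m + 2) (n + 1) + recB d m * zonalGram x m (n + 1) := by
  rw [← integral_mul_zonal_mul hd, ← integral_mul_zonal_mul hd]
  refine integral_congr_ae (Eventually.of_forall fun y => ?_)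
  simp only
  ring

lemma zonalGram_rec_zero (hd : 1 ≤ d) (x : Sph d) (n : ℕ) :
    recA d (n + 1) * zonalGram x (n + 2) 0 + recB d n * zonalGram x n 0 =
      recA d 0 * zonalGram x 1 (n + 1) := by
  rw [← integral_mul_zonal_mul hd, ← integral_mul_zonal_zero_mul hd]
  refine integral_congr_ae (Eventually.of_forall fun y => ?_)
  simp only
  ring

/-- Strong induction on the smaller degree. The symmetric recurrence leaves a single entry not yet
known to vanish, with a positive coefficient; degree 0 is the mean-zero property. -/
lemma zonalGram_of_lt (hd : 1 ≤ d) (x : Sph d) {m n : ℕ} (h : m < n) : zonalGram x n m = 0 := by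
  have h0 : ∀ n, 0 < n → zonalGram x n 0 = 0 := fun n hn => by
    obtain ⟨k, rfl⟩ : ∃ k, n = k + 1 := ⟨n - 1, by omega⟩
    have := integral_zonal_succ hd x k
    simpa [zonalGram, zonal] using this
  induction m using Nat.strong_induction_on generalizing n with
  | _ m ih =>
    match m with
    | 0 => exact h0 n h
    | 1 =>
      obtain ⟨k, rfl⟩ : ∃ k, n = k + 2 := ⟨n - 2, by omega⟩
      have := zonalGram_rec_zero hd x (k + 1)
      rw [h0 _ (by omega), h0 _ (by omega), mul_zero, mul_zero, add_zero] at this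
      rw [zonalGram_comm]
      exact (mul_eq_zero.1 this.symm).resolve_left (recA_pos d 0).ne'
    | m + 2 =>
      obtain ⟨k, rfl⟩ : ∃ k, n = k + 1 := ⟨n - 1, by omega⟩
      have := zonalGram_rec hd x k m
      rw [ih (m + 1) (by omega) (by omega), ih (m + 1) (by omega) (by omega),
        zonalGram_comm x m (k + 1), ih m (by omega) (by omega)] at this
      simp only [mul_zero, add_zero] at this
      rw [zonalGram_comm]
      exact (mul_eq_zero.1 this.symm).resolve_left (recA_pos d _).ne'

/-- Both sides equal ∫ τ Z_n Z_{n+1}, by orthogonality. -/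
lemma zonalGram_self_rec (hd : 1 ≤ d) (x : Sph d) (n : ℕ) :
    recA d n * zonalGram x (n + 1) (n + 1) = recB d n * zonalGram x n n := by
  cases n with
  | zero =>
    have := zonalGram_rec_zero hd x 0
    rw [zonalGram_of_lt hd x (by omega)] at this
    linarith
  | succ n =>
    have := zonalGram_rec hd x (n + 1) n
    rw [zonalGram_of_lt hd x (show n + 1 < n + 1 + 2 by omega),
      zonalGram_comm x n, zonalGram_of_lt hd x (show n < n + 1 + 1 by omega)] at this
    linarith

lemma zonalGram_zero_zero (x : Sph d) : zonalGram x 0 0 = 1 := by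
  simp [zonalGram, zonal]

/-- The squared norm is the dimension of the spherical harmonics of degree k + 1, obtained as a
product of the ratios b_n / a_n. -/
lemma zonalGram_self_succ (hd : 1 ≤ d) (x : Sph d) (k : ℕ) :
    zonalGram x (k + 1) (k + 1) * ((k + 1).factorial * (d - 1).factorial) =
      (2 * k + d + 1) * (k + (d - 1)).factorial := by
  obtain ⟨e, rfl⟩ : ∃ e, d = e + 1 := ⟨d - 1, by omega⟩
  rw [Nat.add_sub_cancel]
  induction k with
  | zero =>
    have := zonalGram_self_rec hd x 0
    rw [zonalGram_zero_zero] at this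
    simp only [recA, recB] at this
    push_cast at this ⊢
    field_simp at this
    simp only [zero_add, Nat.factorial_one, Nat.cast_one, mul_zero, one_mul] at this ⊢
    linear_combination (e.factorial : ℝ) * this
  | succ k ih =>
    have := zonalGram_self_rec hd x (k + 1)
    simp only [recA, recB] at this
    rw [show k + 1 + e = k + e + 1 by ring, factorial_succ_cast (k + e),
      factorial_succ_cast (k + 1)]
    push_cast at this ih ⊢
    field_simp at this
    have hne : (2 * (k : ℝ) + (e + 1) + 1) ≠ 0 := by positivity
    refine mul_left_cancel₀ hne ?_
    linear_combination ((k + 1).factorial : ℝ) * e.factorial * this +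
      (k + (e + 1)) * (2 * (k + 1) + (e + 1) + 1) * ih

/-- The norms of the zonal harmonics grow like `n^(d-1)`. -/
lemma exists_zonalGram_self_le (hd : 1 ≤ d) :
    ∃ C : ℝ, 0 ≤ C ∧ ∀ (x : Sph d) (n : ℕ), zonalGram x n n ≤ C * ((n : ℝ) + 1) ^ (d - 1) := by
  obtain ⟨e, rfl⟩ : ∃ e, d = e + 1 := ⟨d - 1, by omega⟩
  rw [Nat.add_sub_cancel]
  refine ⟨(e + 2) * (e + 1) ^ e, by positivity, fun x n => ?_⟩
  cases n with
  | zero =>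
    rw [zonalGram_zero_zero]
    simp only [Nat.cast_zero, zero_add, one_pow, mul_one]
    have h0 : (0 : ℝ) ≤ e := Nat.cast_nonneg e
    have : (1 : ℝ) ≤ (e + 1) ^ e := one_le_pow₀ (by linarith)
    nlinarith
  | succ k =>
    have h := zonalGram_self_succ hd x k
    rw [Nat.add_sub_cancel] at h
    have hf : ((k + e).factorial : ℝ) ≤ k.factorial * ((k : ℝ) + e) ^ e := by
      rw [← Nat.factorial_mul_ascFactorial]
      exact_mod_cast Nat.mul_le_mul_left _ (Nat.ascFactorial_le_pow_add k e)
    have hk : (0 : ℝ) ≤ k := Nat.cast_nonneg k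
    have he : (0 : ℝ) ≤ e := Nat.cast_nonneg e
    have hpow : ((k : ℝ) + e) ^ e ≤ (e + 1) ^ e * ((k + 1 : ℕ) + 1) ^ e := by
      rw [← mul_pow]
      push_cast
      gcongr
      nlinarith
    have hfac : (1 : ℝ) ≤ e.factorial := by exact_mod_cast Nat.one_le_iff_ne_zero.2 (Nat.factorial_ne_zero e)
    have hpos : (0 : ℝ) < (k + 1).factorial * e.factorial := by positivity
    refine le_of_mul_le_mul_right ?_ hpos
    rw [h, factorial_succ_cast]
    have hk0 : (0 : ℝ) < k.factorial := by positivity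
    have hX : (0 : ℝ) ≤ (e + 1) ^ e * ((k + 1 : ℕ) + 1) ^ e := by positivity
    calc (2 * (k : ℝ) + (e + 1 : ℕ) + 1) * (k + e).factorial
        ≤ ((e + 2) * (k + 1)) * (k.factorial * ((e + 1) ^ e * ((k + 1 : ℕ) + 1) ^ e)) := by
          gcongr
          · push_cast; nlinarith
          · exact hf.trans (by gcongr)
      _ = ((e + 2) * (k + 1)) * (k.factorial * ((e + 1) ^ e * ((k + 1 : ℕ) + 1) ^ e)) * 1 := by ring
      _ ≤ ((e + 2) * (k + 1)) * (k.factorial * ((e + 1) ^ e * ((k + 1 : ℕ) + 1) ^ e)) *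
          e.factorial := by gcongr
      _ = _ := by ring

/-- Parseval's identity for zonal sums. -/
lemma integral_sq_sum_zonal (hd : 1 ≤ d) (x : Sph d) (c : ℕ → ℝ) (R : ℕ) :
    ∫ y, (∑ n ∈ Finset.range R, c n * zonal d n (sphInner x y)) ^ 2 ∂(sphMeasure d) =
      ∑ n ∈ Finset.range R, c n ^ 2 * zonalGram x n n := by
  have hz : ∀ n, Continuous fun y => zonal d n (sphInner x y) := fun n =>
    (continuous_zonal hd n).comp (continuous_sphInner x)
  simp only [sq, Finset.sum_mul_sum]
  rw [integral_finsetSum _ fun n _ => integrable_of_continuous (by fun_prop)]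
  refine Finset.sum_congr rfl fun n hn => ?_
  rw [integral_finsetSum _ fun m _ => integrable_of_continuous (by fun_prop),
    Finset.sum_eq_single_of_mem n hn]
  · rw [zonalGram, ← integral_const_mul]
    refine integral_congr_ae (Eventually.of_forall fun y => ?_)
    simp only
    ring
  · intro m _ hmn
    have : zonalGram x n m = 0 := by
      rcases lt_or_gt_of_ne hmn with h | h
      · exact zonalGram_of_lt hd x h
      · rw [zonalGram_comm]; exact zonalGram_of_lt hd x h
    have e : ∀ y, c n * zonal d n (sphInner x y) * (c m * zonal d m (sphInner x y)) =
        (c n * c m) * (zonal d n (sphInner x y) * zonal d m (sphInner x y)) := fun y => by ring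
    simp only [e]
    rw [integral_const_mul]
    exact mul_eq_zero_of_right _ this

end SphBesov

end

/-! ### Cap measures and localization of the Littlewood–Paley kernels -/

noncomputable section

namespace SphBesov

variable {d : ℕ}

open scoped Pointwise in
/-- Spherical caps of radius `r` have measure at most a constant times `r^d`. -/
lemma sphMeasure_cap_le (p : EuclideanSpace ℝ (Fin (d + 1))) {r : ℝ} (hr : 0 < r) :
    sphMeasure d {y : Sph d | ‖(y : EuclideanSpace ℝ (Fin (d + 1))) - p‖ ≤ r} ≤
      ENNReal.ofReal (2 * 3 ^ (d + 1) * r ^ d) := by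
  set S := {y : Sph d | ‖(y : EuclideanSpace ℝ (Fin (d + 1))) - p‖ ≤ r} with hS
  rcases le_or_gt 1 r with h1 | h1
  · refine (prob_le_one).trans ?_
    rw [← ENNReal.ofReal_one]
    refine ENNReal.ofReal_le_ofReal ?_
    have ha : (1 : ℝ) ≤ 3 ^ (d + 1) := one_le_pow₀ (by norm_num)
    have hb : (1 : ℝ) ≤ r ^ d := one_le_pow₀ h1
    nlinarith
  rcases S.eq_empty_or_nonempty with he | ⟨y₀, hy₀⟩
  · rw [he, measure_empty]
    exact zero_le
  have hp : ‖p‖ ≤ 2 := by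
    have h2 : ‖(y₀ : EuclideanSpace ℝ (Fin (d + 1)))‖ = 1 := by simp
    have := norm_sub_norm_le p (y₀ : EuclideanSpace ℝ (Fin (d + 1)))
    rw [norm_sub_rev] at this
    have h3 : ‖(y₀ : EuclideanSpace ℝ (Fin (d + 1))) - p‖ ≤ r := hy₀
    linarith
  have hSm : MeasurableSet S :=
    (isClosed_le (by fun_prop) continuous_const).measurableSet
  -- The measure of S is proportional to the volume of the cone over S. About 1/r balls of radius
  -- 3r, centred along the segment from 0 to p, cover this cone, so r^(d+1) becomes r^d.
  set n := ⌊1 / r⌋₊ with hn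
  have hcover : Set.Ioo (0 : ℝ) 1 • (Subtype.val '' S) ⊆
      ⋃ i ∈ Finset.range (n + 1), Metric.closedBall (((i : ℝ) * r) • p) (3 * r) := by
    rintro _ ⟨t, ht, _, ⟨y, hy, rfl⟩, rfl⟩
    have hy' : ‖(y : EuclideanSpace ℝ (Fin (d + 1))) - p‖ ≤ r := hy
    have htr : 0 ≤ t / r := div_nonneg ht.1.le hr.le
    simp only [Set.mem_iUnion, Finset.mem_range, exists_prop, Metric.mem_closedBall, dist_eq_norm]
    refine ⟨⌊t / r⌋₊, Nat.lt_succ_of_le (Nat.floor_le_floor ?_), ?_⟩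
    · gcongr
      exact ht.2.le
    · have h2 := Nat.floor_le htr
      have h3 := Nat.lt_floor_add_one (t / r)
      rw [le_div_iff₀ hr] at h2
      rw [div_lt_iff₀ hr] at h3
      have e : t • (y : EuclideanSpace ℝ (Fin (d + 1))) - ((⌊t / r⌋₊ : ℝ) * r) • p =
          t • ((y : EuclideanSpace ℝ (Fin (d + 1))) - p) + (t - (⌊t / r⌋₊ : ℝ) * r) • p := by
        module
      calc _ = ‖t • ((y : EuclideanSpace ℝ (Fin (d + 1))) - p) +
              (t - (⌊t / r⌋₊ : ℝ) * r) • p‖ := by rw [← e]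
        _ ≤ 1 * r + r * 2 := by
          refine (norm_add_le _ _).trans ?_
          rw [norm_smul, norm_smul, Real.norm_of_nonneg ht.1.le, Real.norm_of_nonneg (by linarith)]
          gcongr
          · exact ht.2.le
          · linarith
        _ = 3 * r := by ring
  set V := (volume : Measure (EuclideanSpace ℝ (Fin (d + 1)))) (Metric.ball 0 1) with hV
  have hV0 : V ≠ 0 := (Metric.measure_ball_pos _ _ one_pos).ne'
  have hVt : V ≠ ⊤ := measure_ball_lt_top.ne
  have hvol : (volume : Measure (EuclideanSpace ℝ (Fin (d + 1))))
      (Set.Ioo (0 : ℝ) 1 • (Subtype.val '' S)) ≤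
      ENNReal.ofReal (2 * 3 ^ (d + 1) * r ^ d) * V := by
    refine (measure_mono hcover).trans ((measure_biUnion_finset_le _ _).trans ?_)
    have : ∀ i ∈ Finset.range (n + 1), (volume : Measure (EuclideanSpace ℝ (Fin (d + 1))))
        (Metric.closedBall (((i : ℝ) * r) • p) (3 * r)) = ENNReal.ofReal ((3 * r) ^ (d + 1)) * V := by
      intro i _
      rw [Measure.addHaar_closedBall _ _ (by positivity)]
      simp [hV]
    rw [Finset.sum_congr rfl this, Finset.sum_const, Finset.card_range, nsmul_eq_mul, ← mul_assoc]
    gcongr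
    rw [← ENNReal.ofReal_natCast, ← ENNReal.ofReal_mul (by positivity)]
    refine ENNReal.ofReal_le_ofReal ?_
    have hnr : (n : ℝ) * r ≤ 1 := by
      have := Nat.floor_le (show 0 ≤ 1 / r by positivity)
      rwa [le_div_iff₀ hr] at this
    push_cast
    calc ((n : ℝ) + 1) * (3 * r) ^ (d + 1) = (n * r + r) * (3 ^ (d + 1) * r ^ d) := by
          rw [mul_pow, pow_succ r]; ring
      _ ≤ 2 * (3 ^ (d + 1) * r ^ d) := by gcongr; linarith
      _ = _ := by ring
  have hdim : ((Module.finrank ℝ (EuclideanSpace ℝ (Fin (d + 1))) : ℕ) : ℝ≥0∞) ≠ 0 := by simp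
  have hdimt : ((Module.finrank ℝ (EuclideanSpace ℝ (Fin (d + 1))) : ℕ) : ℝ≥0∞) ≠ ⊤ := by
    simp
  rw [sphMeasure, Measure.smul_apply, smul_eq_mul, Measure.toSphere_apply_univ,
    Measure.toSphere_apply' _ hSm, ← hV]
  calc _ ≤ ((Module.finrank ℝ (EuclideanSpace ℝ (Fin (d + 1))) : ℕ) * V)⁻¹ *
        ((Module.finrank ℝ (EuclideanSpace ℝ (Fin (d + 1))) : ℕ) *
          (ENNReal.ofReal (2 * 3 ^ (d + 1) * r ^ d) * V)) := by gcongr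
    _ = (((Module.finrank ℝ (EuclideanSpace ℝ (Fin (d + 1))) : ℕ) * V)⁻¹ *
        ((Module.finrank ℝ (EuclideanSpace ℝ (Fin (d + 1))) : ℕ) * V)) *
          ENNReal.ofReal (2 * 3 ^ (d + 1) * r ^ d) := by ring
    _ = _ := by rw [ENNReal.inv_mul_cancel (mul_ne_zero hdim hV0) (ENNReal.mul_ne_top hdimt hVt),
        one_mul]

lemma zonalGram_self_nonneg (x : Sph d) (n : ℕ) : 0 ≤ zonalGram x n n :=
  integral_nonneg fun _ => mul_self_nonneg _

/-- The samples `a(2^(-i) n)` of the cut-off. -/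
def sample (a : ℝ → ℝ) (i n : ℕ) : ℝ := a ((2 : ℝ) ^ (-(i : ℤ)) * (n : ℝ))

lemma IsCutoff.eq_zero_of_notMem {a : ℝ → ℝ} (ha : IsCutoff a) {t : ℝ}
    (ht : t ∉ Set.Icc (1 / 2 : ℝ) 2) : a t = 0 :=
  image_eq_zero_of_notMem_tsupport fun h => ht (ha.supp h)

lemma sample_eq_zero_of_le {a : ℝ → ℝ} (ha : IsCutoff a) {i n : ℕ} (hn : 2 ^ (i + 1) + 1 ≤ n) :
    sample a i n = 0 := by
  refine ha.eq_zero_of_notMem fun h => ?_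
  have h2 := h.2
  have hn' : (2 : ℝ) ^ (i + 1) + 1 ≤ n := by exact_mod_cast hn
  rw [zpow_neg, zpow_natCast, inv_mul_le_iff₀ (by positivity)] at h2
  rw [pow_succ] at hn'
  linarith

lemma sample_eq_zero_of_lt {a : ℝ → ℝ} (ha : IsCutoff a) {i n : ℕ} (hn : n < (2 ^ i + 1) / 2) :
    sample a i n = 0 := by
  refine ha.eq_zero_of_notMem fun h => ?_
  have h1 := h.1
  have hn1 : 2 * n < 2 ^ i := by omega
  have hn' : 2 * (n : ℝ) < 2 ^ i := by exact_mod_cast hn1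
  rw [zpow_neg, zpow_natCast, le_inv_mul_iff₀ (by positivity)] at h1
  linarith

lemma lpKernel_succ {a : ℝ → ℝ} (ha : IsCutoff a) (i : ℕ) (t : ℝ) :
    lpKernel d a (i + 1) t =
      ∑ n ∈ Finset.range (2 ^ (i + 1) + 1), sample a i n * zonal d n t := by
  have e : (1 : ℤ) - ((i + 1 : ℕ) : ℤ) = -(i : ℤ) := by push_cast; ring
  rw [lpKernel, if_neg (Nat.succ_ne_zero i), e]
  refine tsum_eq_sum fun n hn => ?_
  have : sample a i n = 0 := sample_eq_zero_of_le ha (by simpa using hn)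
  rw [sample] at this
  rw [this, zero_mul]

lemma continuous_lpKernel_succ (hd : 1 ≤ d) {a : ℝ → ℝ} (ha : IsCutoff a) (i : ℕ) :
    Continuous (lpKernel d a (i + 1)) := by
  have hz := continuous_zonal hd
  have : lpKernel d a (i + 1) =
      fun t => ∑ n ∈ Finset.range (2 ^ (i + 1) + 1), sample a i n * zonal d n t :=
    funext fun t => lpKernel_succ ha i t
  rw [this]
  fun_prop

/-- This cancellation is what lets f(y) be replaced by f(y) - f(x). -/
lemma integral_lpKernel_succ (hd : 1 ≤ d) {a : ℝ → ℝ} (ha : IsCutoff a) (i : ℕ) (x : Sph d) :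
    ∫ y, lpKernel d a (i + 1) (sphInner x y) ∂(sphMeasure d) = 0 := by
  have hz : ∀ n, Continuous fun y => zonal d n (sphInner x y) := fun n =>
    (continuous_zonal hd n).comp (continuous_sphInner x)
  simp only [lpKernel_succ ha]
  rw [integral_finsetSum _ fun n _ => integrable_of_continuous (by fun_prop)]
  refine Finset.sum_eq_zero fun n _ => ?_
  rw [integral_const_mul]
  cases n with
  | zero =>
    have : sample a i 0 = 0 := by
      rw [sample, Nat.cast_zero, mul_zero]
      exact ha.eq_zero_of_notMem (by norm_num)
    rw [this, zero_mul]
  | succ k => rw [integral_zonal_succ hd, mul_zero]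

/-- Weighted `L²` bounds for the Littlewood–Paley kernels. -/
lemma exists_weighted_sq_bound (hd : 1 ≤ d) {a : ℝ → ℝ} (ha : IsCutoff a) (M : ℕ) :
    ∃ C : ℝ, 0 ≤ C ∧ ∀ (i : ℕ) (x : Sph d),
      ((2 : ℝ) ^ i) ^ (4 * M) * ∫ y, ((1 - sphInner x y) ^ M *
        lpKernel d a (i + 1) (sphInner x y)) ^ 2 ∂(sphMeasure d) ≤ C * ((2 : ℝ) ^ i) ^ d := by
  have hsymb : Symb (0 + 2 * M) 0 (sample a) := symb_sample ha _
  obtain ⟨C₁, hC₁⟩ := hsymb.diffOp_iterate d M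
  obtain ⟨C₂, hC₂, hC₂'⟩ := exists_zonalGram_self_le hd
  rw [zero_add] at hC₁
  refine ⟨(2 * ((M : ℝ) + 1)) ^ (4 * M) * (C₁ ^ 2 * C₂) * ((M : ℝ) + 3) ^ d, by positivity,
    fun i x => ?_⟩
  have hcont := continuous_sphInner x
  set c := (diffOp d)^[M] (sample a i) with hc
  have hint : ∫ y, ((1 - sphInner x y) ^ M * lpKernel d a (i + 1) (sphInner x y)) ^ 2
      ∂(sphMeasure d) = ∑ n ∈ Finset.range (2 ^ (i + 1) + 1 + M), c n ^ 2 * zonalGram x n n := by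
    rw [← integral_sq_sum_zonal hd]
    refine integral_congr_ae (Eventually.of_forall fun y => ?_)
    simp only
    rw [lpKernel_succ ha, pow_mul_sum_zonal hd (fun n hn => sample_eq_zero_of_le ha hn)]
  rw [hint, Finset.mul_sum]
  have hN : (1 : ℝ) ≤ 2 ^ i := one_le_pow₀ (by norm_num)
  have hM : (0 : ℝ) ≤ M := Nat.cast_nonneg M
  -- B bounds each term. There are at most (M + 3) 2^i of them, which raises the exponent d - 1 to
  -- d.
  set B : ℝ := (2 * ((M : ℝ) + 1)) ^ (4 * M) * (C₁ ^ 2 * C₂) * (((M : ℝ) + 3) * 2 ^ i) ^ (d - 1) with hBdef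
  have hterm : ∀ n ∈ Finset.range (2 ^ (i + 1) + 1 + M),
      ((2 : ℝ) ^ i) ^ (4 * M) * (c n ^ 2 * zonalGram x n n) ≤ B := by
    intro n hn
    have hn1 : n < 2 ^ (i + 1) + 1 + M := by simpa using hn
    -- Below this threshold the coefficient is zero; above it 2^i ≤ 2(M + 1)(n + 1), so the weight
    -- is absorbed by the symbol bound.
    by_cases hlow : n + M < (2 ^ i + 1) / 2
    · rw [hc, diffOp_iterate_eq_zero_of_add_le (fun n hn => sample_eq_zero_of_lt ha hn) M hlow]
      have : (0 : ℝ) ≤ B := by positivity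
      simpa using this
    · have h1 : 2 ^ i ≤ 2 * (n + M) := by omega
      have h1' : (2 : ℝ) ^ i ≤ 2 * ((n : ℝ) + M) := by exact_mod_cast h1
      have h2 : (2 : ℝ) ^ i ≤ 2 * ((M : ℝ) + 1) * (n + 1) := by
        have : (0 : ℝ) ≤ M * n := by positivity
        nlinarith
      have h3 : (n : ℝ) + 1 ≤ ((M : ℝ) + 3) * 2 ^ i := by
        have h4 : (n : ℝ) + 1 ≤ 2 ^ (i + 1) + 1 + M := by exact_mod_cast hn1
        rw [pow_succ] at h4
        nlinarith
      have h5 : (((n : ℝ) + 1) ^ (2 * M) * |c n|) ^ 2 ≤ C₁ ^ 2 := by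
        gcongr
        exact hC₁ i n
      have hg := zonalGram_self_nonneg x n
      calc ((2 : ℝ) ^ i) ^ (4 * M) * (c n ^ 2 * zonalGram x n n)
          ≤ (2 * ((M : ℝ) + 1) * (n + 1)) ^ (4 * M) *
            (c n ^ 2 * (C₂ * ((n : ℝ) + 1) ^ (d - 1))) := by
            gcongr
            exact hC₂' x n
        _ = (2 * ((M : ℝ) + 1)) ^ (4 * M) * ((((n : ℝ) + 1) ^ (2 * M) * |c n|) ^ 2 *
            C₂) * ((n : ℝ) + 1) ^ (d - 1) := by
            rw [mul_pow, mul_pow _ |c n|, sq_abs, ← pow_mul, show 2 * M * 2 = 4 * M by ring]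
            ring
        _ ≤ B := by rw [hBdef]; gcongr
  refine (Finset.sum_le_card_nsmul _ _ _ hterm).trans ?_
  rw [Finset.card_range, nsmul_eq_mul]
  have hB : (0 : ℝ) ≤ B := by positivity
  calc ((2 ^ (i + 1) + 1 + M : ℕ) : ℝ) * B ≤ (((M : ℝ) + 3) * 2 ^ i) * B := by
        gcongr
        push_cast
        rw [pow_succ]
        nlinarith
    _ = (2 * ((M : ℝ) + 1)) ^ (4 * M) * (C₁ ^ 2 * C₂) *
        ((((M : ℝ) + 3) * 2 ^ i) ^ (d - 1) * (((M : ℝ) + 3) * 2 ^ i)) := by ring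
    _ = _ := by rw [← pow_succ, Nat.sub_add_cancel hd, mul_pow ((M : ℝ) + 3)]; ring

/-- The dyadic annuli around `x` at the scale `2^(-i)`; the one with index `0` is a cap. -/
def annulus (i k : ℕ) (x : Sph d) : Set (Sph d) :=
  {y | dist y x ≤ 2 ^ k / 2 ^ i ∧ (k = 0 ∨ (2 : ℝ) ^ k / 2 ^ i ≤ 2 * dist y x)}

lemma measurableSet_annulus (i k : ℕ) (x : Sph d) : MeasurableSet (annulus i k x) := by
  have h1 : MeasurableSet {y : Sph d | dist y x ≤ 2 ^ k / 2 ^ i} :=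
    (isClosed_le (by fun_prop) continuous_const).measurableSet
  have h2 : MeasurableSet {y : Sph d | (2 : ℝ) ^ k / 2 ^ i ≤ 2 * dist y x} :=
    (isClosed_le continuous_const (by fun_prop)).measurableSet
  exact h1.inter ((MeasurableSet.const _).union h2)

/-- The least admissible k works; it is at most i + 1 because the sphere has diameter 2. -/
lemma exists_mem_annulus (i : ℕ) (x y : Sph d) : ∃ k ∈ Finset.range (i + 2), y ∈ annulus i k x := by
  have hle : dist y x ≤ 2 ^ (i + 1) / 2 ^ i := by
    have h2 : dist y x ≤ 2 := by
      rw [Subtype.dist_eq, dist_eq_norm]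
      refine (norm_sub_le _ _).trans ?_
      simp
      norm_num
    rw [pow_succ]
    field_simp
    exact h2
  have hex : ∃ k, dist y x ≤ 2 ^ k / 2 ^ i := ⟨_, hle⟩
  classical
  refine ⟨Nat.find hex, ?_, Nat.find_spec hex, ?_⟩
  · exact Finset.mem_range.2 (Nat.lt_succ_of_le (Nat.find_min' hex hle))
  · rcases Nat.eq_zero_or_pos (Nat.find hex) with h | h
    · exact Or.inl h
    · right
      obtain ⟨m, hm⟩ : ∃ m, Nat.find hex = m + 1 := ⟨Nat.find hex - 1, by omega⟩
      have := Nat.find_min hex (show m < Nat.find hex by omega)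
      rw [not_le] at this
      rw [hm, pow_succ]
      rw [mul_comm ((2 : ℝ) ^ m), mul_div_assoc]
      linarith

lemma dist_sq_eq (x y : Sph d) : dist y x ^ 2 = 2 * (1 - sphInner x y) := by
  rw [Subtype.dist_eq, dist_eq_norm, norm_sub_sq_real, real_inner_comm]
  simp
  ring

/-- Localization of the Littlewood–Paley kernels. -/
lemma exists_integral_annulus_le (hd : 1 ≤ d) {a : ℝ → ℝ} (ha : IsCutoff a) (M : ℕ) :
    ∃ C : ℝ, 0 ≤ C ∧ ∀ (i k : ℕ) (x : Sph d),
      ∫ y in annulus i k x, |lpKernel d a (i + 1) (sphInner x y)| ∂(sphMeasure d) ≤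
        C * ((2 : ℝ) ^ k) ^ d / ((2 : ℝ) ^ k) ^ (2 * M) := by
  obtain ⟨C₀, hC₀, hC₀'⟩ := exists_weighted_sq_bound hd ha 0
  obtain ⟨C₁, hC₁, hC₁'⟩ := exists_weighted_sq_bound hd ha M
  set K : ℝ := 2 * 3 ^ (d + 1)
  -- `C₀` serves the cap k = 0. For k ≥ 1 the factor 8 comes from |y - x|² = 2(1 - τ) and |y - x| ≥
  -- Q/(2N).
  set C₂ : ℝ := C₀ + 8 ^ (2 * M) * C₁
  refine ⟨C₂ + K, by positivity, fun i k x => ?_⟩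
  have hker : Continuous fun y => lpKernel d a (i + 1) (sphInner x y) :=
    (continuous_lpKernel_succ hd ha i).comp (continuous_sphInner x)
  have hinn := continuous_sphInner x
  set N : ℝ := 2 ^ i with hN
  set Q : ℝ := 2 ^ k with hQ
  have hN0 : 0 < N := by positivity
  have hQ0 : 0 < Q := by positivity
  have hQ1 : 1 ≤ Q := one_le_pow₀ (by norm_num)
  have hsq : ∫ y in annulus i k x, lpKernel d a (i + 1) (sphInner x y) ^ 2 ∂(sphMeasure d) ≤
      C₂ * N ^ d / Q ^ (4 * M) := by
    have hint : ∀ m : ℕ, Integrable (fun y => ((1 - sphInner x y) ^ m *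
        lpKernel d a (i + 1) (sphInner x y)) ^ 2) (sphMeasure d) := fun m =>
      integrable_of_continuous (by fun_prop)
    rcases Nat.eq_zero_or_pos k with hk | hk
    · have hQ1 : Q = 1 := by simp [hQ, hk]
      have h := hC₀' i x
      simp only [mul_zero, pow_zero, one_mul] at h
      rw [hQ1, one_pow, div_one]
      refine (setIntegral_le_integral ?_ (Eventually.of_forall fun y => sq_nonneg _)).trans
        (h.trans ?_)
      · simpa using hint 0
      · gcongr
        have : 0 ≤ 8 ^ (2 * M) * C₁ := by positivity
        linarith
    · have hpt : ∀ y ∈ annulus i k x, lpKernel d a (i + 1) (sphInner x y) ^ 2 ≤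
          (8 * N ^ 2 / Q ^ 2) ^ (2 * M) *
            ((1 - sphInner x y) ^ M * lpKernel d a (i + 1) (sphInner x y)) ^ 2 := by
        intro y hy
        have h1 : Q / N ≤ 2 * dist y x := hy.2.resolve_left hk.ne'
        have h2 : (Q / N) ^ 2 ≤ 8 * (1 - sphInner x y) := by
          calc (Q / N) ^ 2 ≤ (2 * dist y x) ^ 2 := by gcongr
            _ = _ := by rw [mul_pow, dist_sq_eq]; ring
        have h3 : 1 ≤ 8 * N ^ 2 / Q ^ 2 * (1 - sphInner x y) := by
          rw [div_pow, div_le_iff₀ (by positivity)] at h2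
          rw [div_mul_eq_mul_div, le_div_iff₀ (by positivity)]
          linarith
        have h4 := one_le_pow₀ (n := 2 * M) h3
        calc lpKernel d a (i + 1) (sphInner x y) ^ 2
            = 1 * lpKernel d a (i + 1) (sphInner x y) ^ 2 := by ring
          _ ≤ (8 * N ^ 2 / Q ^ 2 * (1 - sphInner x y)) ^ (2 * M) *
              lpKernel d a (i + 1) (sphInner x y) ^ 2 := by gcongr
          _ = _ := by 
            rw [mul_pow _ (1 - sphInner x y), mul_pow (_ ^ M), ← pow_mul (1 - sphInner x y),
              mul_comm M 2]
            ring
      calc ∫ y in annulus i k x, lpKernel d a (i + 1) (sphInner x y) ^ 2 ∂(sphMeasure d)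
          ≤ ∫ y in annulus i k x, (8 * N ^ 2 / Q ^ 2) ^ (2 * M) *
            ((1 - sphInner x y) ^ M * lpKernel d a (i + 1) (sphInner x y)) ^ 2 ∂(sphMeasure d) := by
            refine setIntegral_mono_on ?_ ((hint M).const_mul _).integrableOn
              (measurableSet_annulus i k x) hpt
            exact (integrable_of_continuous (by fun_prop)).integrableOn
        _ = (8 * N ^ 2 / Q ^ 2) ^ (2 * M) * ∫ y in annulus i k x,
            ((1 - sphInner x y) ^ M * lpKernel d a (i + 1) (sphInner x y)) ^ 2 ∂(sphMeasure d) :=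
            integral_const_mul _ _
        _ ≤ (8 * N ^ 2 / Q ^ 2) ^ (2 * M) * ∫ y,
            ((1 - sphInner x y) ^ M * lpKernel d a (i + 1) (sphInner x y)) ^ 2 ∂(sphMeasure d) := by
            refine mul_le_mul_of_nonneg_left ?_ (by positivity)
            exact setIntegral_le_integral (hint M) (Eventually.of_forall fun y => sq_nonneg _)
        _ = 8 ^ (2 * M) / Q ^ (4 * M) * (N ^ (4 * M) * ∫ y,
            ((1 - sphInner x y) ^ M * lpKernel d a (i + 1) (sphInner x y)) ^ 2
              ∂(sphMeasure d)) := by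
            rw [div_pow, mul_pow, ← pow_mul, ← pow_mul, show 2 * (2 * M) = 4 * M by ring]
            ring
        _ ≤ 8 ^ (2 * M) / Q ^ (4 * M) * (C₁ * N ^ d) := by
            exact mul_le_mul_of_nonneg_left (hC₁' i x) (by positivity)
        _ = 8 ^ (2 * M) * C₁ * N ^ d / Q ^ (4 * M) := by ring
        _ ≤ C₂ * N ^ d / Q ^ (4 * M) := by gcongr; linarith
  have hcap : (sphMeasure d).real (annulus i k x) ≤ K * (Q / N) ^ d := by
    refine ENNReal.toReal_le_of_le_ofReal (by positivity) ?_
    refine (measure_mono ?_).trans (sphMeasure_cap_le (x : EuclideanSpace ℝ (Fin (d + 1)))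
      (show 0 < Q / N by positivity))
    intro y hy
    have := hy.1
    rwa [Subtype.dist_eq, dist_eq_norm] at this
  -- Cauchy–Schwarz in the form |u| ≤ ρu² + 1/ρ; this ρ removes N from both resulting terms.
  set ρ : ℝ := Q ^ (2 * M) / N ^ d with hρ
  have hρ0 : 0 < ρ := by positivity
  have hI2 : IntegrableOn (fun y => lpKernel d a (i + 1) (sphInner x y) ^ 2) (annulus i k x)
      (sphMeasure d) := (integrable_of_continuous (by fun_prop)).integrableOn
  calc ∫ y in annulus i k x, |lpKernel d a (i + 1) (sphInner x y)| ∂(sphMeasure d)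
      ≤ ∫ y in annulus i k x, (ρ * lpKernel d a (i + 1) (sphInner x y) ^ 2 + 1 / ρ)
        ∂(sphMeasure d) := by
        refine setIntegral_mono ?_ ?_ fun y => ?_
        · exact (integrable_of_continuous (by fun_prop)).integrableOn
        · exact (integrable_of_continuous (by fun_prop)).integrableOn
        · simp only
          set u := lpKernel d a (i + 1) (sphInner x y)
          have h1 : ρ * (1 / ρ) = 1 := by field_simp
          have h2 : 0 ≤ (|u| * ρ - 1) ^ 2 := sq_nonneg _
          have h3 : |u| * ρ ≤ (ρ * u ^ 2 + 1 / ρ) * ρ := by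
            rw [add_mul, one_div, inv_mul_cancel₀ hρ0.ne', ← sq_abs u]
            nlinarith [sq_nonneg (|u| * ρ)]
          exact le_of_mul_le_mul_right h3 hρ0
    _ = ρ * ∫ y in annulus i k x, lpKernel d a (i + 1) (sphInner x y) ^ 2 ∂(sphMeasure d) +
        (sphMeasure d).real (annulus i k x) * (1 / ρ) := by
        rw [integral_add (hI2.const_mul ρ) (integrable_const _), integral_const_mul]
        simp
    _ ≤ ρ * (C₂ * N ^ d / Q ^ (4 * M)) + K * (Q / N) ^ d * (1 / ρ) := by gcongr
    _ = C₂ * 1 / Q ^ (2 * M) + K * Q ^ d / Q ^ (2 * M) := by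
        rw [hρ, show 4 * M = 2 * M + 2 * M by ring, pow_add, div_pow]
        field_simp
    _ ≤ C₂ * Q ^ d / Q ^ (2 * M) + K * Q ^ d / Q ^ (2 * M) := by
        gcongr
        exact one_le_pow₀ hQ1
    _ = _ := by ring

end SphBesov

end

/-! ### From box counting to mean oscillation -/

noncomputable section

namespace SphBesov

variable {d : ℕ}

/-- Two points of the sphere at distance `r < 1` are joined within the cap of radius `2r`:
the values of a continuous function between them are taken on this cap. -/
lemma uIcc_subset_image_cap {f : Sph d → ℝ} (hf : Continuous f) {r : ℝ} (hr : r < 1) {x y : Sph d}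
    (hxy : dist x y ≤ r) :
    Set.uIcc (f x) (f y) ⊆ f '' {z | dist x z ≤ 2 * r} := by
  -- The chord stays within r of x, and away from 0 since r < 1. Radial projection to the sphere
  -- moves its points by at most another r.
  set z : Set.Icc (0 : ℝ) 1 → EuclideanSpace ℝ (Fin (d + 1)) :=
    fun t => (x : EuclideanSpace ℝ (Fin (d + 1))) +
      (t : ℝ) • ((y : EuclideanSpace ℝ (Fin (d + 1))) - x) with hz
  have hx1 : ‖(x : EuclideanSpace ℝ (Fin (d + 1)))‖ = 1 := by simp
  have hy1 : ‖(y : EuclideanSpace ℝ (Fin (d + 1)))‖ = 1 := by simp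
  rw [Subtype.dist_eq, dist_eq_norm, norm_sub_rev] at hxy
  have hzx : ∀ t, ‖z t - x‖ ≤ r := fun t => by
    rw [hz, add_sub_cancel_left, norm_smul, Real.norm_of_nonneg t.2.1]
    exact (mul_le_of_le_one_left (norm_nonneg _) t.2.2).trans hxy
  have hzn : ∀ t, |1 - ‖z t‖| ≤ r := fun t => by
    rw [← hx1, abs_sub_comm]
    exact (abs_norm_sub_norm_le _ _).trans (hzx t)
  have hz0 : ∀ t, 0 < ‖z t‖ := fun t => by
    have := (abs_le.1 (hzn t)).2
    linarith
  have hzc : Continuous z := by fun_prop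
  set g : Set.Icc (0 : ℝ) 1 → Sph d := fun t => ⟨‖z t‖⁻¹ • z t, by
    rw [mem_sphere_zero_iff_norm, norm_smul, norm_inv, norm_norm, inv_mul_cancel₀ (hz0 t).ne']⟩
    with hg
  have hgc : Continuous g :=
    ((hzc.norm.inv₀ fun t => (hz0 t).ne').smul hzc).subtype_mk _
  have hgx : ∀ t, dist x (g t) ≤ 2 * r := fun t => by
    rw [Subtype.dist_eq, dist_comm]
    have e : ‖z t‖⁻¹ • z t - z t = ((1 - ‖z t‖) * ‖z t‖⁻¹) • z t := by
      rw [sub_mul, mul_inv_cancel₀ (hz0 t).ne', sub_smul, one_mul, one_smul]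
    have e2 : dist (‖z t‖⁻¹ • z t) (z t) ≤ r := by
      rw [dist_eq_norm, e, norm_smul, norm_mul, norm_inv, norm_norm, mul_assoc,
        inv_mul_cancel₀ (hz0 t).ne', mul_one]
      exact hzn t
    have e3 : dist (z t) x ≤ r := by rw [dist_eq_norm]; exact hzx t
    calc dist (‖z t‖⁻¹ • z t) (x : EuclideanSpace ℝ (Fin (d + 1))) ≤ _ := dist_triangle _ (z t) _
      _ ≤ 2 * r := by linarith
  have h0 : g ⟨0, by norm_num⟩ = x := by
    apply Subtype.ext
    simp [hg, hz]
  have h1 : g ⟨1, by norm_num⟩ = y := by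
    apply Subtype.ext
    simp [hg, hz]
  have hpre : IsPreconnected (Set.range (f ∘ g)) := isPreconnected_range (hf.comp hgc)
  have hsub := hpre.ordConnected.uIcc_subset (x := f x) (y := f y)
    ⟨⟨0, by norm_num⟩, congrArg f h0⟩ ⟨⟨1, by norm_num⟩, congrArg f h1⟩
  rintro v hv
  obtain ⟨t, rfl⟩ := hsub hv
  exact ⟨g t, hgx t, rfl⟩

/-- The projection of `ℝ^(d+2)` to the first `d + 1` coordinates. -/
def baseProj (p : Fin (d + 2) → ℝ) : EuclideanSpace ℝ (Fin (d + 1)) :=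
  WithLp.toLp 2 fun i => p i.castSucc

lemma norm_sub_baseProj_le {p : Fin (d + 2) → ℝ} {z : Sph d} {v ρ : ℝ}
    (h : dist (Fin.snoc (fun i => (z : EuclideanSpace ℝ (Fin (d + 1))) i) v : Fin (d + 2) → ℝ) p ≤ ρ) :
    ‖(z : EuclideanSpace ℝ (Fin (d + 1))) - baseProj p‖ ≤ (d + 1) * ρ := by
  have hρ : 0 ≤ ρ := dist_nonneg.trans h
  have hc : ∀ i : Fin (d + 1), ‖((z : EuclideanSpace ℝ (Fin (d + 1))) - baseProj p) i‖ ≤ ρ := by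
    intro i
    have := (dist_le_pi_dist _ _ i.castSucc).trans h
    rw [Fin.snoc_castSucc, Real.dist_eq] at this
    exact this
  rw [EuclideanSpace.norm_eq]
  refine Real.sqrt_le_iff.2 ⟨by positivity, ?_⟩
  calc _ ≤ ∑ _i : Fin (d + 1), ρ ^ 2 := by
        refine Finset.sum_le_sum fun i _ => ?_
        gcongr
        exact hc i
    _ = ((d : ℝ) + 1) * 1 * ρ ^ 2 := by simp
    _ ≤ ((d : ℝ) + 1) * (d + 1) * ρ ^ 2 := by
        gcongr
        linarith [(Nat.cast_nonneg d : (0 : ℝ) ≤ d)]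
    _ = _ := by ring

lemma abs_sub_le_of_dist_snoc_le {p : Fin (d + 2) → ℝ} {w : Fin (d + 1) → ℝ} {v ρ : ℝ}
    (h : dist (Fin.snoc w v : Fin (d + 2) → ℝ) p ≤ ρ) :
    |v - p (Fin.last (d + 1))| ≤ ρ := by
  have := (dist_le_pi_dist _ _ (Fin.last (d + 1))).trans h
  rwa [Fin.snoc_last, Real.dist_eq] at this

/-- The oscillation of `f` in terms of a cover of its graph by cubes. -/
lemma abs_sub_le_card_cover {f : Sph d → ℝ} (hf : Continuous f) {r : ℝ} (hr0 : 0 < r) (hr : r < 1)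
    {A : Finset (Fin (d + 2) → ℝ)}
    (hA : sphGraph f ⊆ ⋃ p ∈ A, Metric.closedBall p (r / 2)) {x y : Sph d} (hxy : dist x y ≤ r) :
    |f x - f y| ≤ r * ∑ p ∈ A, {z : Sph d | ‖(z : EuclideanSpace ℝ (Fin (d + 1))) - baseProj p‖ ≤
      (d + 3) * r}.indicator (fun _ => (1 : ℝ)) x := by
  classical
  -- A cube containing a graph point over z, with |x - z| ≤ 2r, has its centre projected within 2r +
  -- (d + 1) r/2 ≤ (d + 3) r of x.
  set B := A.filter fun p => ‖(x : EuclideanSpace ℝ (Fin (d + 1))) - baseProj p‖ ≤ (d + 3) * r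
    with hB
  -- The shadows of these cubes on the last axis are intervals of length r covering everything
  -- between f(x) and f(y), so comparing lengths bounds the oscillation by r · #B.
  have hcov : Set.uIcc (f x) (f y) ⊆
      ⋃ p ∈ B, Metric.closedBall (p (Fin.last (d + 1))) (r / 2) := by
    intro v hv
    obtain ⟨z, hz, rfl⟩ := uIcc_subset_image_cap hf hr hxy hv
    have hmem : (Fin.snoc (fun i => (z : EuclideanSpace ℝ (Fin (d + 1))) i) (f z) :
      Fin (d + 2) → ℝ) ∈ sphGraph f := ⟨z, rfl⟩
    obtain ⟨p, hp, hzp⟩ := Set.mem_iUnion₂.1 (hA hmem)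
    rw [Metric.mem_closedBall] at hzp
    refine Set.mem_iUnion₂.2 ⟨p, ?_, ?_⟩
    · rw [hB, Finset.mem_filter]
      refine ⟨hp, ?_⟩
      have h1 := norm_sub_baseProj_le hzp
      have h2 : ‖(x : EuclideanSpace ℝ (Fin (d + 1))) - z‖ ≤ 2 * r := by
        rw [← dist_eq_norm, ← Subtype.dist_eq]; exact hz
      have h3 := norm_sub_le_norm_sub_add_norm_sub (x : EuclideanSpace ℝ (Fin (d + 1)))
        (z : EuclideanSpace ℝ (Fin (d + 1))) (baseProj p)
      have : 0 ≤ (d : ℝ) * r := by positivity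
      linarith
    · rw [Metric.mem_closedBall, Real.dist_eq]
      exact abs_sub_le_of_dist_snoc_le hzp
  have hvol := (measure_mono (μ := volume) hcov).trans (measure_biUnion_finset_le B _)
  simp only [Real.volume_interval, Real.volume_closedBall, Finset.sum_const, nsmul_eq_mul] at hvol
  rw [← ENNReal.ofReal_natCast, ← ENNReal.ofReal_mul (by positivity),
    ENNReal.ofReal_le_ofReal_iff (by positivity), abs_sub_comm] at hvol
  have hsum : ∑ p ∈ A, {z : Sph d | ‖(z : EuclideanSpace ℝ (Fin (d + 1))) - baseProj p‖ ≤
      (d + 3) * r}.indicator (fun _ => (1 : ℝ)) x = B.card := by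
    simp only [Set.indicator_apply, Set.mem_ofPred_eq]
    rw [Finset.sum_ite, Finset.sum_const_zero, add_zero, Finset.sum_const, nsmul_eq_mul, mul_one]
  rw [hsum]
  linarith

/-- A covering bound for the graph controls the oscillation of `f` on average. -/
lemma exists_oscillation_bound {f : Sph d → ℝ} (hf : Continuous f) {γ ε₀ : ℝ} (hε₀ : 0 < ε₀)
    (hN : ∀ ε, 0 < ε → ε < ε₀ →
      ((boxCount (sphGraph f) ε : ℕ∞) : ℝ≥0∞) ≤ ENNReal.ofReal (ε ^ (-γ))) :
    ∃ C : ℝ, 0 ≤ C ∧ ∀ r, 0 < r → r ≤ 2 → ∃ G : Sph d → ℝ, Measurable G ∧ (∀ x, 0 ≤ G x) ∧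
      (∀ x y, dist x y ≤ r → |f x - f y| ≤ G x) ∧
      ∫⁻ x, ENNReal.ofReal (G x) ∂(sphMeasure d) ≤
        ENNReal.ofReal (C * r ^ ((d : ℝ) + 1 - γ)) := by
  set β : ℝ := (d : ℝ) + 1 - γ with hβ
  obtain ⟨b, hb⟩ : ∃ b, ∀ x, |f x| ≤ b := by
    obtain ⟨b, hb⟩ := (isCompact_univ (X := Sph d)).exists_bound_of_continuousOn hf.continuousOn
    exact ⟨b, fun x => hb x trivial⟩
  set ε₁ := min ε₀ 1 with hε₁
  have hε₁0 : 0 < ε₁ := lt_min hε₀ one_pos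
  -- For scales in [ε₁, 2] the trivial bound 2 sup |f| suffices; κ is a lower bound of r^β there,
  -- whatever the sign of β.
  set κ : ℝ := min (ε₁ ^ β) (2 ^ β) with hκ
  have hκ0 : 0 < κ := lt_min (Real.rpow_pos_of_pos hε₁0 _) (Real.rpow_pos_of_pos two_pos _)
  set K : ℝ := 2 * 3 ^ (d + 1) * (d + 3) ^ d with hK
  refine ⟨max K (2 * |b| / κ), le_max_of_le_left (by positivity), fun r hr hr2 => ?_⟩
  have hrβ : 0 < r ^ β := Real.rpow_pos_of_pos hr _
  rcases lt_or_ge r ε₁ with hlt | hge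
  · have hr1 : r < 1 := hlt.trans_le (min_le_right _ _)
    have hbox := hN r hr (hlt.trans_le (min_le_left _ _))
    have hfin : boxCount (sphGraph f) r ≠ ⊤ := by
      intro h
      rw [h] at hbox
      exact absurd (top_le_iff.1 hbox) ENNReal.ofReal_ne_top
    obtain ⟨A, hAcov, hAcard⟩ : ∃ A : Finset (Fin (d + 2) → ℝ),
        sphGraph f ⊆ ⋃ p ∈ A, Metric.closedBall p (r / 2) ∧
        (A.card : ℝ≥0∞) ≤ ENNReal.ofReal (r ^ (-γ)) := by
      -- A finite covering number is below itself plus one, which extracts an optimal cover from the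
      -- infimum.
      have hlt' : boxCount (sphGraph f) r < boxCount (sphGraph f) r + 1 :=
        (ENat.lt_add_one_iff hfin).2 le_rfl
      nth_rw 1 [boxCount] at hlt'
      rw [Metric.externalCoveringNumber] at hlt'
      simp only [iInf_lt_iff] at hlt'
      obtain ⟨A, hA, hAlt⟩ := hlt'
      have hAle := (ENat.lt_add_one_iff hfin).1 hAlt
      have hAfin : A.Finite := Set.encard_lt_top_iff.1 (hAle.trans_lt (lt_top_iff_ne_top.2 hfin))
      refine ⟨hAfin.toFinset, ?_, ?_⟩
      · have := hA.subset_iUnion_closedBall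
        rw [Real.coe_toNNReal _ (by positivity)] at this
        simpa using this
      · refine le_trans ?_ hbox
        rw [hAfin.encard_eq_coe_toFinset_card] at hAle
        exact_mod_cast ENat.toENNReal_le.2 hAle
    have hcard : (A.card : ℝ) ≤ r ^ (-γ) := by
      rw [← ENNReal.ofReal_natCast] at hAcard
      exact (ENNReal.ofReal_le_ofReal_iff (by positivity)).1 hAcard
    set cap : (Fin (d + 2) → ℝ) → Set (Sph d) := fun p =>
      {z : Sph d | ‖(z : EuclideanSpace ℝ (Fin (d + 1))) - baseProj p‖ ≤ (d + 3) * r} with hcap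
    have hcapm : ∀ p, MeasurableSet (cap p) := fun p =>
      (isClosed_le (by fun_prop) continuous_const).measurableSet
    refine ⟨fun x => r * ∑ p ∈ A, (cap p).indicator (fun _ => (1 : ℝ)) x, ?_, ?_, ?_, ?_⟩
    · exact (Finset.measurable_sum _ fun p _ => measurable_const.indicator (hcapm p)).const_mul r
    · exact fun x => mul_nonneg hr.le (Finset.sum_nonneg fun p _ =>
        Set.indicator_nonneg (fun _ _ => zero_le_one) _)
    · exact fun x y hxy => abs_sub_le_card_cover hf hr hr1 hAcov hxy
    · have e : ∀ x, ENNReal.ofReal (r * ∑ p ∈ A, (cap p).indicator (fun _ => (1 : ℝ)) x) =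
          ENNReal.ofReal r * ∑ p ∈ A, (cap p).indicator (fun _ => (1 : ℝ≥0∞)) x := fun x => by
        rw [ENNReal.ofReal_mul hr.le, ENNReal.ofReal_sum_of_nonneg fun p _ =>
          Set.indicator_nonneg (fun _ _ => zero_le_one) _]
        congr 1
        refine Finset.sum_congr rfl fun p _ => ?_
        by_cases h : x ∈ cap p <;> simp [h]
      simp only [e]
      rw [lintegral_const_mul _ (Finset.measurable_sum _ fun p _ =>
        measurable_const.indicator (hcapm p)), lintegral_finsetSum _ fun p _ =>
        measurable_const.indicator (hcapm p)]
      calc ENNReal.ofReal r * ∑ p ∈ A, ∫⁻ x, (cap p).indicator (fun _ => (1 : ℝ≥0∞)) x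
            ∂(sphMeasure d)
          ≤ ENNReal.ofReal r * ∑ _p ∈ A, ENNReal.ofReal (K * r ^ d) := by
            gcongr with p _
            rw [lintegral_indicator_const (hcapm p), one_mul]
            refine (sphMeasure_cap_le (baseProj p) (show 0 < ((d : ℝ) + 3) * r by positivity)).trans
              (le_of_eq ?_)
            rw [mul_pow, hK]
            ring_nf
        _ = ENNReal.ofReal (r * (A.card * (K * r ^ d))) := by
            rw [Finset.sum_const, nsmul_eq_mul, ENNReal.ofReal_mul hr.le,
              ENNReal.ofReal_mul (Nat.cast_nonneg _), ENNReal.ofReal_natCast]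
        _ ≤ ENNReal.ofReal (max K (2 * |b| / κ) * r ^ β) := by
            refine ENNReal.ofReal_le_ofReal ?_
            calc r * (A.card * (K * r ^ d)) ≤ r * (r ^ (-γ) * (K * r ^ d)) := by gcongr
              _ = K * r ^ β := by
                rw [hβ, show (d : ℝ) + 1 - γ = (d : ℝ) + 1 + -γ by ring, Real.rpow_add hr,
                  Real.rpow_add hr, Real.rpow_one, Real.rpow_natCast]
                ring
              _ ≤ _ := by gcongr; exact le_max_left _ _
  · refine ⟨fun _ => 2 * |b|, measurable_const, fun _ => by positivity, fun x y _ => ?_, ?_⟩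
    · have h1 := (hb x).trans (le_abs_self b)
      have h2 := (hb y).trans (le_abs_self b)
      exact (abs_sub _ _).trans (by linarith)
    · rw [lintegral_const, measure_univ, mul_one]
      refine ENNReal.ofReal_le_ofReal ?_
      have hκr : κ ≤ r ^ β := by
        rcases le_total 0 β with h | h
        · exact (min_le_left _ _).trans (Real.rpow_le_rpow hε₁0.le hge h)
        · exact (min_le_right _ _).trans (Real.rpow_le_rpow_of_nonpos hr hr2 h)
      calc 2 * |b| = 2 * |b| / κ * κ := by field_simp
        _ ≤ max K (2 * |b| / κ) * r ^ β := by gcongr; exact le_max_right _ _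

end SphBesov

end

/-! ### From mean oscillation to Besov regularity -/

noncomputable section

namespace SphBesov

variable {d : ℕ}

/-- Pointwise estimate of `f * Φ_j` by the oscillations of `f` on dyadic caps. -/
lemma abs_sphConv_lpKernel_le (hd : 1 ≤ d) {a : ℝ → ℝ} (ha : IsCutoff a) {f : Sph d → ℝ}
    (hf : Continuous f) (i : ℕ) (x : Sph d) {g : ℕ → ℝ}
    (hg : ∀ k ∈ Finset.range (i + 2), ∀ y, dist y x ≤ 2 ^ k / 2 ^ i → |f x - f y| ≤ g k) :
    |sphConv f (lpKernel d a (i + 1)) x| ≤ ∑ k ∈ Finset.range (i + 2), g k *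
      ∫ y in annulus i k x, |lpKernel d a (i + 1) (sphInner x y)| ∂(sphMeasure d) := by
  have hker : Continuous fun y => lpKernel d a (i + 1) (sphInner x y) :=
    (continuous_lpKernel_succ hd ha i).comp (continuous_sphInner x)
  set F : Sph d → ℝ := fun y => |f x - f y| * |lpKernel d a (i + 1) (sphInner x y)| with hF
  have hFc : Continuous F := by fun_prop
  have hF0 : ∀ y, 0 ≤ F y := fun y => by positivity
  have h1 : sphConv f (lpKernel d a (i + 1)) x =
      ∫ y, (f y - f x) * lpKernel d a (i + 1) (sphInner x y) ∂(sphMeasure d) := by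
    simp only [sub_mul]
    rw [integral_sub (integrable_of_continuous (by fun_prop))
      (integrable_of_continuous (by fun_prop)), integral_const_mul,
      integral_lpKernel_succ hd ha, mul_zero, sub_zero]
    rfl
  have h2 : |∫ y, (f y - f x) * lpKernel d a (i + 1) (sphInner x y) ∂(sphMeasure d)| ≤
      ∫ y, F y ∂(sphMeasure d) := by
    refine (abs_integral_le_integral_abs).trans (le_of_eq ?_)
    refine integral_congr_ae (Eventually.of_forall fun y => ?_)
    simp only [hF]
    rw [abs_mul, abs_sub_comm]
  have h3 : ∫ y, F y ∂(sphMeasure d) ≤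
      ∑ k ∈ Finset.range (i + 2), ∫ y in annulus i k x, F y ∂(sphMeasure d) := by
    simp only [← integral_indicator (measurableSet_annulus i _ x)]
    have hint : ∀ k, Integrable ((annulus i k x).indicator F) (sphMeasure d) := fun k =>
      (integrable_of_continuous hFc).indicator (measurableSet_annulus i k x)
    rw [← integral_finsetSum _ fun k _ => hint k]
    refine integral_mono (integrable_of_continuous hFc) (integrable_finsetSum _ fun k _ => hint k)
      fun y => ?_
    obtain ⟨k, hk, hy⟩ := exists_mem_annulus i x y
    refine le_trans (le_of_eq ?_) (Finset.single_le_sum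
      (f := fun k => (annulus i k x).indicator F y)
      (fun k _ => Set.indicator_nonneg (fun y _ => hF0 y) y) hk)
    simp only [Set.indicator_of_mem hy]
  rw [h1]
  refine h2.trans (h3.trans (Finset.sum_le_sum fun k hk => ?_))
  rw [← integral_const_mul]
  refine setIntegral_mono_on (integrable_of_continuous hFc).integrableOn
    (integrable_of_continuous (by fun_prop)).integrableOn (measurableSet_annulus i k x)
    fun y hy => ?_
  exact mul_le_mul_of_nonneg_right (hg k hk y hy.1) (abs_nonneg _)

/-- Average control of the oscillation gives Besov regularity. -/
lemma mem_besov_of_oscillation (hd : 1 ≤ d) {a : ℝ → ℝ} (ha : IsCutoff a) {f : Sph d → ℝ}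
    (hf : Continuous f) {β C : ℝ} (hC : 0 ≤ C)
    (hosc : ∀ r, 0 < r → r ≤ 2 → ∃ G : Sph d → ℝ, Measurable G ∧ (∀ x, 0 ≤ G x) ∧
      (∀ x y, dist x y ≤ r → |f x - f y| ≤ G x) ∧
      ∫⁻ x, ENNReal.ofReal (G x) ∂(sphMeasure d) ≤ ENNReal.ofReal (C * r ^ β)) :
    f ∈ besov d a β 1 := by
  refine ⟨integrable_of_continuous hf, ?_⟩
  -- Chosen so that d - 2M + β ≤ -1: the contribution of the k-th annulus is then at most a multiple
  -- of 2^(-k).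
  obtain ⟨M, hM⟩ := exists_nat_ge ((d : ℝ) + β + 1)
  obtain ⟨C₁, hC₁, hann⟩ := exists_integral_annulus_le hd ha M
  choose! G hGm hG0 hGosc hGint using hosc
  -- The first entry is the level j = 0, where f * Φ_0 is the mean of f. In the second, 2 sums the
  -- geometric series and 2^β comes from the shift j = i + 1.
  refine lt_of_le_of_lt (b := ENNReal.ofReal (max (|∫ y, f y ∂(sphMeasure d)|)
    (2 * (C₁ * C * 2 ^ β)))) (iSup_le fun j => ?_) ENNReal.ofReal_lt_top
  rw [eLpNorm_one_eq_lintegral_enorm]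
  cases j with
  | zero =>
    have : ∀ x, sphConv f (lpKernel d a 0) x = ∫ y, f y ∂(sphMeasure d) := fun x => by
      simp [sphConv, lpKernel, zonal]
    simp only [this, lintegral_const, measure_univ, mul_one, Nat.cast_zero, zero_mul,
      Real.rpow_zero, ENNReal.ofReal_one, one_mul, Real.enorm_eq_ofReal_abs]
    exact ENNReal.ofReal_le_ofReal (le_max_left _ _)
  | succ i =>
    set r : ℕ → ℝ := fun k => 2 ^ k / 2 ^ i with hr
    have hr0 : ∀ k, 0 < r k := fun k => by positivity
    have hr2 : ∀ k ∈ Finset.range (i + 2), r k ≤ 2 := fun k hk => by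
      rw [hr, div_le_iff₀ (by positivity), ← pow_succ']
      exact pow_le_pow_right₀ (by norm_num) (by have := Finset.mem_range.1 hk; omega)
    set V : ℕ → ℝ := fun k => C₁ * ((2 : ℝ) ^ k) ^ d / ((2 : ℝ) ^ k) ^ (2 * M) with hV
    have hV0 : ∀ k, 0 ≤ V k := fun k => by positivity
    have hpt : ∀ x, ‖sphConv f (lpKernel d a (i + 1)) x‖ₑ ≤
        ∑ k ∈ Finset.range (i + 2), ENNReal.ofReal (V k) * ENNReal.ofReal (G (r k) x) := by
      intro x
      have hnn : ∀ k ∈ Finset.range (i + 2), 0 ≤ V k * G (r k) x := fun k hk =>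
        mul_nonneg (hV0 k) (hG0 _ (hr0 k) (hr2 k hk) x)
      simp only [← ENNReal.ofReal_mul (hV0 _)]
      rw [Real.enorm_eq_ofReal_abs, ← ENNReal.ofReal_sum_of_nonneg hnn]
      refine ENNReal.ofReal_le_ofReal ?_
      refine (abs_sphConv_lpKernel_le hd ha hf i x (g := fun k => G (r k) x)
        fun k hk y hy => hGosc _ (hr0 k) (hr2 k hk) x y (by rwa [dist_comm])).trans
        (Finset.sum_le_sum fun k hk => ?_)
      rw [mul_comm]
      exact mul_le_mul_of_nonneg_right (hann i k x) (hG0 _ (hr0 k) (hr2 k hk) x)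
    have hint : ∫⁻ x, ‖sphConv f (lpKernel d a (i + 1)) x‖ₑ ∂(sphMeasure d) ≤
        ENNReal.ofReal (∑ k ∈ Finset.range (i + 2), V k * (C * r k ^ β)) := by
      refine (lintegral_mono hpt).trans ?_
      rw [lintegral_finsetSum' _ fun k hk => ((hGm _ (hr0 k)
          (hr2 k hk)).ennreal_ofReal.const_mul _).aemeasurable,
        ENNReal.ofReal_sum_of_nonneg fun k _ => mul_nonneg (hV0 k)
          (mul_nonneg hC (Real.rpow_nonneg (hr0 k).le _))]
      refine Finset.sum_le_sum fun k hk => ?_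
      rw [lintegral_const_mul _ (hGm _ (hr0 k) (hr2 k hk)).ennreal_ofReal,
        ENNReal.ofReal_mul (hV0 k)]
      gcongr
      exact hGint _ (hr0 k) (hr2 k hk)
    have hterm : ∀ k, (2 : ℝ) ^ (((i + 1 : ℕ) : ℝ) * β) * (V k * (C * r k ^ β)) ≤
        C₁ * C * 2 ^ β * (1 / 2) ^ k := by
      intro k
      have hQ : (1 : ℝ) ≤ 2 ^ k := one_le_pow₀ (by norm_num)
      have hQ0 : (0 : ℝ) < 2 ^ k := by positivity
      have e1 : (2 : ℝ) ^ (((i + 1 : ℕ) : ℝ) * β) * r k ^ β = 2 ^ β * ((2 : ℝ) ^ k) ^ β := by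
        rw [Real.rpow_mul (by norm_num), Real.rpow_natCast, ← Real.mul_rpow (by positivity)
          (hr0 k).le, ← Real.mul_rpow (by norm_num) (by positivity)]
        congr 1
        rw [hr, pow_succ]
        field_simp
      have e2 : ((2 : ℝ) ^ k) ^ d / ((2 : ℝ) ^ k) ^ (2 * M) * ((2 : ℝ) ^ k) ^ β ≤ (1 / 2) ^ k := by
        rw [← Real.rpow_natCast, ← Real.rpow_natCast _ (2 * M), ← Real.rpow_sub hQ0,
          ← Real.rpow_add hQ0, one_div, inv_pow, ← Real.rpow_neg_one]
        refine Real.rpow_le_rpow_of_exponent_le hQ ?_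
        push_cast
        have : (0 : ℝ) ≤ M := Nat.cast_nonneg M
        linarith
      calc (2 : ℝ) ^ (((i + 1 : ℕ) : ℝ) * β) * (V k * (C * r k ^ β))
          = V k * C * ((2 : ℝ) ^ (((i + 1 : ℕ) : ℝ) * β) * r k ^ β) := by ring
        _ = C₁ * C * 2 ^ β *
            (((2 : ℝ) ^ k) ^ d / ((2 : ℝ) ^ k) ^ (2 * M) * ((2 : ℝ) ^ k) ^ β) := by
            rw [e1, hV]; ring
        _ ≤ _ := by gcongr
    calc _ ≤ ENNReal.ofReal ((2 : ℝ) ^ (((i + 1 : ℕ) : ℝ) * β)) *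
          ENNReal.ofReal (∑ k ∈ Finset.range (i + 2), V k * (C * r k ^ β)) := by gcongr
      _ = ENNReal.ofReal (∑ k ∈ Finset.range (i + 2),
          (2 : ℝ) ^ (((i + 1 : ℕ) : ℝ) * β) * (V k * (C * r k ^ β))) := by
          rw [← ENNReal.ofReal_mul (by positivity), Finset.mul_sum]
      _ ≤ _ := by
        refine ENNReal.ofReal_le_ofReal (le_max_of_le_right ?_)
        refine (Finset.sum_le_sum fun k _ => hterm k).trans ?_
        rw [← Finset.mul_sum, mul_comm (2 : ℝ)]
        gcongr
        exact sum_geometric_two_le _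

/-- A bound for the upper box dimension gives covering bounds at all small scales. -/
lemma exists_boxCount_le_of_upperBoxDim_lt {m : ℕ} {E : Set (Fin m → ℝ)} {γ : ℝ}
    (h : upperBoxDim E < (γ : EReal)) :
    ∃ ε₀ > 0, ∀ ε, 0 < ε → ε < ε₀ →
      ((boxCount E ε : ℕ∞) : ℝ≥0∞) ≤ ENNReal.ofReal (ε ^ (-γ)) := by
  have hev := eventually_lt_of_limsup_lt h
  obtain ⟨ε₁, hε₁, hlt⟩ := mem_nhdsGT_iff_exists_Ioo_subset.1 hev
  -- Keeping ε below 1 makes log(1/ε) positive, so the quotient can be cleared.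
  refine ⟨min ε₁ 1, lt_min hε₁ one_pos, fun ε h0 hε => ?_⟩
  have h1 : ε < 1 := hε.trans_le (min_le_right _ _)
  have hlog : 0 < Real.log (1 / ε) := Real.log_pos (by rw [lt_div_iff₀ h0]; linarith)
  have h2 : ENNReal.log (boxCount E ε : ℝ≥0∞) / ((Real.log (1 / ε) : ℝ) : EReal) < γ :=
    hlt ⟨h0, hε.trans_le (min_le_left _ _)⟩
  rw [EReal.div_lt_iff (by exact_mod_cast hlog) (EReal.coe_ne_top _)] at h2
  rw [← ENNReal.log_le_log_iff, ENNReal.log_ofReal_of_pos (Real.rpow_pos_of_pos h0 _),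
    Real.log_rpow h0]
  refine h2.le.trans (le_of_eq ?_)
  rw [← EReal.coe_mul, one_div, Real.log_inv]
  congr 1
  ring

end SphBesov

end

theorem mainTheorem8 (d : ℕ) (hd : 1 ≤ d)
    (a : ℝ → ℝ) (ha : SphBesov.IsCutoff a) (s : ℝ)
    (f : SphBesov.Sph d → ℝ) (hf : Continuous f)
    (hfs : f ∉ ⋃ (ε : ℝ) (_ : 0 < ε), SphBesov.besov d a (s + ε) 1) :
    (((d : ℝ) + 1 - s : ℝ) : EReal) ≤ SphBesov.upperBoxDim (SphBesov.sphGraph f) := by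
  by_contra hlt
  obtain ⟨γ, hγ, hγs⟩ := EReal.lt_iff_exists_real_btwn.1 (not_le.1 hlt)
  have hγs' : γ < (d : ℝ) + 1 - s := by exact_mod_cast hγs
  obtain ⟨ε₀, hε₀, hN⟩ := SphBesov.exists_boxCount_le_of_upperBoxDim_lt hγ
  obtain ⟨C, hC, hosc⟩ := SphBesov.exists_oscillation_bound hf hε₀ hN
  have hmem := SphBesov.mem_besov_of_oscillation hd ha hf hC hosc
  -- The witness is β - s, positive by the choice of γ.
  refine hfs (Set.mem_iUnion₂.2 ⟨(d : ℝ) + 1 - γ - s, by linarith, ?_⟩)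
  rwa [show s + ((d : ℝ) + 1 - γ - s) = (d : ℝ) + 1 - γ by ring]
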